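/- For $L\ge 2$ let $\beta_1,\gamma_1,\dots,\beta_L,\gamma_L$ be Hermitian Majorana operators on the $2^L$-dimensional Fock space, $\{\beta_i,\beta_j\}=\{\gamma_i,\gamma_j\}=2\delta_{ij}$, $\{\beta_i,\gamma_j\}=0$ (realized by the Jordan–Wigner transformation). For $0\le\alpha\le 1$ put, on the periodic chain ($\beta_{L+j}:=\beta_j$, $\gamma_{L+j}:=\gamma_j$), $$R^{\rm PBC}(\alpha)=\sum_{j=1}^{L}\bigl\{(1-\alpha)\beta_j+\alpha\, i\beta_j\beta_{j+1}\gamma_j\bigr\},\qquad H^{\rm PBC}(\alpha)=\tfrac12 R^{\rm PBC}(\alpha)^2,$$ and on the open chain $$R^{\rm OBC}(\alpha)=(1-\alpha)\sum_{j=2}^{L-1}\beta_j+\alpha\sum_{j=1}^{L-1} i\beta_j\beta_{j+1}\gamma_j,\qquad H^{\rm OBC}(\alpha)=\tfrac12 R^{\rm OBC}(\alpha)^2.$$ Let also $$H_{\rm CTI}=\sum_{j=1}^{L}\bigl(i\beta_{j+1}\gamma_j-i\beta_{j-1}\gamma_{j-1}\bigr),\qquad H_{\rm int}=\tfrac12\Bigl(\sum_{j=1}^{L}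 i\beta_j\beta_{j+1}\gamma_j\Bigr)^2$$ on the periodic chain. The ground-state energy of an operator is its least eigenvalue; $E_{\rm g.s.}(\alpha;L)$ denotes that of $H^{\rm PBC}(\alpha)$, and $e_{\rm g.s.}(\alpha)=\lim_{L\to\infty}E_{\rm g.s.}(\alpha;L)/L$. Supersymmetry is called spontaneously broken at $\alpha$ if $e_{\rm g.s.}(\alpha)>0$. Then: 1. $H_{\rm int}\ge 0$ for every $L\ge2$, and the ground-state energy of $H_{\rm CTI}$ divided by $L$ tends to $-4/\pi$ as $L\to\infty$. 2. For every $\alpha\in[0,1]$ the limit $e_{\rm g.s.}(\alpha)$ exists, the open chain $H^{\rm OBC}(\alpha)$ has the same ground-state energy density, and $$e_{\rm g.s.}(\alpha)\ \ge\ \frac{(1-\alpha)^2}{2}-\frac{4\alpha(1-\alpha)}{\pi}.$$ 3. Supersymmetry is spontaneously broken for every $0\le\alpha<\frac{\pi}{8+\pi}$, whereas $e_{\rm g.s.}(1/2)=0$. 4. Suppose that there is a single transition, at $\alpha_c\in[0,1]$; that is, supersymmetry is spontaneously broken for all $0\le\alpha<\alpha_c$ and is not spontaneously broken for any $\alpha_c<\alpha\le1$.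 Then $\frac{\pi}{8+\pi}\le\alpha_c\le\frac12$. -/

import Mathlib

open Filter Topology
open scoped ComplexOrder

noncomputable section

namespace SusyMajorana

/-- Spin configurations of a chain of `L` sites. They label an orthonormal basis of the
`2 ^ L`-dimensional Fock space of the `2 L` Majorana fermions; in each factor the index `0` is the
spin-up state and `1` the spin-down state. -/
abbrev Config (L : ℕ) : Type := Fin L → Fin 2

/-- Linear operators on the Fock space of the chain of `L` sites, as matrices. -/
abbrev Op (L : ℕ) : Type := Matrix (Config L) (Config L) ℂ

/-- The Pauli matrix `σˣ`. -/
def pauliX : Matrix (Fin 2) (Fin 2) ℂ := !![0, 1; 1, 0]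

/-- The Pauli matrix `σʸ`. -/
def pauliY : Matrix (Fin 2) (Fin 2) ℂ := !![0, -Complex.I; Complex.I, 0]

/-- The Pauli matrix `σᶻ`. -/
def pauliZ : Matrix (Fin 2) (Fin 2) ℂ := !![1, 0; 0, -1]

/-- The tensor product `A 0 ⊗ A 1 ⊗ ⋯ ⊗ A (L - 1)` of one-site operators. -/
def tensorOp {L : ℕ} (A : Fin L → Matrix (Fin 2) (Fin 2) ℂ) : Op L :=
  Matrix.of fun s t => ∏ i, A i (s i) (t i)

/-- The Majorana operator `β_j = σˣ_j ∏_{i < j} (-σᶻ_i)` (Jordan-Wigner). -/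
def majoranaB {L : ℕ} (j : Fin L) : Op L :=
  tensorOp fun i => if i < j then -pauliZ else if i = j then pauliX else 1

/-- The Majorana operator `γ_j = σʸ_j ∏_{i < j} (-σᶻ_i)` (Jordan-Wigner). -/
def majoranaC {L : ℕ} (j : Fin L) : Op L :=
  tensorOp fun i => if i < j then -pauliZ else if i = j then pauliY else 1

/-- The cyclic successor `j + 1` (modulo `L`) of the site `j`. -/
def next {L : ℕ} (j : Fin L) : Fin L := finRotate L j

/-- The cyclic predecessor `j - 1` (modulo `L`) of the site `j`. -/
def prev {L : ℕ} (j : Fin L) : Fin L := (finRotate L).symm j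

/-- The cubic term `i β_j β_{j+1} γ_j`. -/
def cubicTerm {L : ℕ} (j : Fin L) : Op L :=
  Complex.I • (majoranaB j * majoranaB (next j) * majoranaC j)

/-- The supercharge `R(α) = ∑_j ((1 - α) β_j + α i β_j β_{j+1} γ_j)` of the periodic chain. -/
def superchargePBC (L : ℕ) (α : ℝ) : Op L :=
  ∑ j : Fin L, ((1 - α) • majoranaB j + α • cubicTerm j)

/-- The supercharge of the open chain. The linear terms run over all sites but the first and the
last one, the cubic terms over all sites but the last one (so that no bond wraps around). -/
def superchargeOBC (L : ℕ) (α : ℝ) : Op L :=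
  (1 - α) • (∑ j : Fin L with 0 < j.val ∧ j.val + 1 < L, majoranaB j) +
    α • (∑ j : Fin L with j.val + 1 < L, cubicTerm j)

/-- The Hamiltonian `H(α) = R(α)² / 2` of the periodic chain. -/
def hamiltonianPBC (L : ℕ) (α : ℝ) : Op L :=
  (1 / 2 : ℝ) • superchargePBC L α ^ 2

/-- The Hamiltonian `H(α) = R(α)² / 2` of the open chain. -/
def hamiltonianOBC (L : ℕ) (α : ℝ) : Op L :=
  (1 / 2 : ℝ) • superchargeOBC L α ^ 2

/-- The critical Kitaev chain `H_CTI = ∑_j (i β_{j+1} γ_j - i β_{j-1} γ_{j-1})`, periodic. -/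
def kitaevPBC (L : ℕ) : Op L :=
  ∑ j : Fin L, (Complex.I • (majoranaB (next j) * majoranaC j) -
    Complex.I • (majoranaB (prev j) * majoranaC (prev j)))

/-- The interaction `H_int = (∑_j i β_j β_{j+1} γ_j)² / 2`, periodic. -/
def interactionPBC (L : ℕ) : Op L :=
  (1 / 2 : ℝ) • (∑ j : Fin L, cubicTerm j) ^ 2

/-- The ground-state energy of a Hermitian operator: its least (real) eigenvalue. -/
def groundEnergy {L : ℕ} (H : Op L) : ℝ := sInf (spectrum ℝ H)

/-- The ground-state energy density `e_gs(α) = lim_{L → ∞} E_gs(α; L) / L` (periodic chain). -/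
def energyDensity (α : ℝ) : ℝ :=
  limUnder atTop fun L : ℕ => groundEnergy (hamiltonianPBC L α) / (L : ℝ)

/-- Supersymmetry is spontaneously broken (in the infinite chain). -/
def SusyBroken (α : ℝ) : Prop := 0 < energyDensity α

/-- `αc` is the critical point of a single transition on `0 ≤ α ≤ 1`: supersymmetry is broken
everywhere below `αc` and nowhere above it. -/
def IsCriticalPoint (αc : ℝ) : Prop :=
  αc ∈ Set.Icc (0 : ℝ) 1 ∧ (∀ α ∈ Set.Ico 0 αc, SusyBroken α) ∧
    ∀ α ∈ Set.Ioc αc 1, ¬ SusyBroken α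

end SusyMajorana

end

open SusyMajorana

/-! Squaring the supercharge gives `H(α) = (1-α)²L/2 + α(1-α) H_CTI + α² H_int`
(`hamiltonianPBC_eq`): the linear part squares to `L`, and its anticommutator with the cubic part is
twice the Kitaev chain. Since `H_int ≥ 0` is half a square, the ground energy is bounded below by
that of the free-fermion part.

The Kitaev chain is solved exactly. With modes `d_k = ∑_j w^(2j) (β_j + w γ_j)`, `w = exp(-iπk/L)`,
and energies `ε_k = 2 sin(πk/L) ≥ 0`, one has `∑_k ε_k d_k† d_k = 2L (H_CTI + S)` with `S = ∑_k ε_k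
= 2 cot(π/2L)` (`kitaevPBC_diagonal`). So `H_CTI ≥ -S`. Equality is attained because the modes `0 <
k < L` anticommute and square to zero, hence have a common kernel vector. The limit of `-S/L` is
`-4/π`.

The energy density exists by Fekete's lemma applied to an auxiliary open chain with linear terms on
all sites. Cutting one of its bonds leaves two decoupled fermionic chains, whose energies add. The
cut costs a bounded amount: `R² - Q²` is governed by the anticommutator of `R` with the removed
cubic term, and odd local operators with disjoint supports anticommute. The periodic and the given
open supercharges differ from the auxiliary one by a bounded operator, which changes the energy only
by `o(L)` (`tendsto_groundEnergy_of_norm_sub_le`).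

At `α = 1/2` a Fock vacuum with `β_j v = i γ_j v` turns each cubic term into `-β_{j+1}`, so the
supercharge kills it. The bounds on the critical point follow from these two regimes. -/

namespace SusyMajorana

open scoped MatrixOrder Matrix.Norms.L2Operator

/-! ### Ground-state energy: spectral and operator-order estimates. -/

section GroundEnergy

variable {L : ℕ}

lemma exists_eigenvector_groundEnergy {H : Op L} (hH : H.IsHermitian) :
    ∃ v : Config L → ℂ, v ≠ 0 ∧ H.mulVec v = (groundEnergy H : ℂ) • v := by
  have hs := hH.spectrum_real_eq_range_eigenvalues
  have hfin : (spectrum ℝ H).Finite := hs ▸ Set.finite_range _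
  have hne : (spectrum ℝ H).Nonempty := hs ▸ Set.range_nonempty _
  have hmem : groundEnergy H ∈ spectrum ℝ H := hne.csInf_mem hfin
  rw [hs] at hmem
  obtain ⟨i, hi⟩ := hmem
  refine ⟨hH.eigenvectorBasis i, ?_, ?_⟩
  · intro h
    apply hH.eigenvectorBasis.orthonormal.ne_zero i
    ext j
    exact congrFun h j
  · rw [hH.mulVec_eigenvectorBasis, hi]
    ext j
    simp

/-- The spectrum is finite and nonempty, so lower bounds on the ground energy are exactly scalar
lower bounds in the Loewner order. -/
lemma algebraMap_le_iff_le_groundEnergy {H : Op L} (hH : H.IsHermitian) {c : ℝ} :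
    algebraMap ℝ (Op L) c ≤ H ↔ c ≤ groundEnergy H := by
  have hs := hH.spectrum_real_eq_range_eigenvalues
  have hfin : (spectrum ℝ H).Finite := hs ▸ Set.finite_range _
  have hne : (spectrum ℝ H).Nonempty := hs ▸ Set.range_nonempty _
  rw [algebraMap_le_iff_le_spectrum (a := H) (ha := hH)]
  exact (le_csInf_iff hfin.bddBelow hne).symm

lemma groundEnergy_le_of_eigenvector {H : Op L} (hH : H.IsHermitian) {v : Config L → ℂ}
    (hv : v ≠ 0) {c : ℝ} (h : H.mulVec v = (c : ℂ) • v) : groundEnergy H ≤ c := by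
  have hs := hH.spectrum_real_eq_range_eigenvalues
  have hfin : (spectrum ℝ H).Finite := hs ▸ Set.finite_range _
  refine csInf_le hfin.bddBelow ?_
  rw [spectrum.mem_iff]
  intro hu
  apply hv
  have h0 : (algebraMap ℝ (Op L) c - H).mulVec v = 0 := by
    rw [Matrix.sub_mulVec, h, Algebra.algebraMap_eq_smul_one, Matrix.smul_mulVec,
      Matrix.one_mulVec]
    ext j
    simp
  obtain ⟨u, hu⟩ := hu
  -- Outside the spectrum `c - H` would be invertible, yet it kills `v`.
  calc v = ((↑u⁻¹ : Op L) * ↑u).mulVec v := by simp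
    _ = 0 := by rw [← Matrix.mulVec_mulVec, hu, h0, Matrix.mulVec_zero]

lemma groundEnergy_le_of_le {A B : Op L} (hA : A.IsHermitian) (hB : B.IsHermitian) {s c : ℝ}
    (hs : 0 < s) (h : B ≤ s • A + algebraMap ℝ (Op L) c) :
    groundEnergy B ≤ s * groundEnergy A + c := by
  have h1 : algebraMap ℝ (Op L) (groundEnergy B) ≤ s • A + algebraMap ℝ (Op L) c :=
    ((algebraMap_le_iff_le_groundEnergy hB).2 le_rfl).trans h
  have h2 : algebraMap ℝ (Op L) (s⁻¹ * (groundEnergy B - c)) ≤ A := by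
    have h3 : algebraMap ℝ (Op L) (groundEnergy B - c) ≤ s • A := by
      rw [map_sub]; exact sub_le_iff_le_add.2 h1
    have h4 : s⁻¹ • algebraMap ℝ (Op L) (groundEnergy B - c) ≤ s⁻¹ • (s • A) :=
      smul_le_smul_of_nonneg_left h3 (inv_nonneg.2 hs.le)
    rwa [smul_smul, inv_mul_cancel₀ hs.ne', one_smul, Algebra.smul_def, ← map_mul] at h4
  have h5 := (algebraMap_le_iff_le_groundEnergy hA).1 h2
  rw [inv_mul_le_iff₀ hs] at h5
  linarith

lemma groundEnergy_le_add_norm {A B : Op L} (hA : A.IsHermitian) (hB : B.IsHermitian) {c : ℝ}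
    (h : ‖B - A‖ ≤ c) : groundEnergy B ≤ groundEnergy A + c := by
  have h1 : B - A ≤ algebraMap ℝ (Op L) ‖B - A‖ :=
    IsSelfAdjoint.le_algebraMap_norm_self (hB.sub hA)
  have h2 : algebraMap ℝ (Op L) ‖B - A‖ ≤ algebraMap ℝ (Op L) c := algebraMap_mono _ h
  have := groundEnergy_le_of_le hA hB (s := 1) (c := c) one_pos
    (by rw [one_smul, add_comm]; exact sub_le_iff_le_add.1 (h1.trans h2))
  simpa using this

lemma sq_posSemidef {A : Op L} (hA : A.IsHermitian) : (A ^ 2).PosSemidef := by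
  have := Matrix.posSemidef_conjTranspose_mul_self A
  rwa [hA.eq, ← sq] at this

lemma half_sq_isHermitian {A : Op L} (hA : A.IsHermitian) :
    ((1 / 2 : ℝ) • A ^ 2).IsHermitian := by
  have := hA.pow 2
  rw [Matrix.IsHermitian, Matrix.conjTranspose_smul, this.eq]
  simp

lemma groundEnergy_half_sq_nonneg {A : Op L} (hA : A.IsHermitian) :
    0 ≤ groundEnergy ((1 / 2 : ℝ) • A ^ 2) := by
  rw [← algebraMap_le_iff_le_groundEnergy (half_sq_isHermitian hA), map_zero]
  exact smul_nonneg (by norm_num) (Matrix.nonneg_iff_posSemidef.2 (sq_posSemidef hA))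

lemma norm_le_one_of_sq_eq_one {A : Op L} (hA : A.IsHermitian) (h : A * A = 1) : ‖A‖ ≤ 1 := by
  have h1 : ‖star A * A‖ = ‖A‖ * ‖A‖ := CStarRing.norm_star_mul_self
  rw [Matrix.star_eq_conjTranspose, hA.eq, h, norm_one] at h1
  nlinarith [norm_nonneg A]

/-- Two Hermitian charges at bounded distance have Hamiltonians with comparable ground states. -/
lemma groundEnergy_half_sq_le {A B : Op L} (hA : A.IsHermitian) (hB : B.IsHermitian) {C ε : ℝ}
    (h : ‖B - A‖ ≤ C) (hε : 0 < ε) :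
    groundEnergy ((1 / 2 : ℝ) • B ^ 2) ≤
      (1 + ε) * groundEnergy ((1 / 2 : ℝ) • A ^ 2) + (1 + 1 / ε) * C ^ 2 / 2 := by
  apply groundEnergy_le_of_le (half_sq_isHermitian hA) (half_sq_isHermitian hB) (by positivity)
  set D := B - A with hD
  have hDh : D.IsHermitian := hB.sub hA
  have hBA : B = A + D := by rw [hD]; abel
  have h1 : D ^ 2 ≤ algebraMap ℝ (Op L) (C ^ 2) := by
    have := IsSelfAdjoint.le_algebraMap_norm_self (a := D ^ 2) (hDh.pow 2)
    refine this.trans (algebraMap_mono _ ?_)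
    calc ‖D ^ 2‖ ≤ ‖D‖ ^ 2 := norm_pow_le _ _
      _ ≤ C ^ 2 := by gcongr
  -- Operator form of Young's inequality: this square yields `A D + D A ≤ ε A² + D²/ε`, which
  -- absorbs the cross term of `(A + D)²`.
  have h2 : 0 ≤ (√ε • A - (√ε)⁻¹ • D) ^ 2 := by
    refine Matrix.nonneg_iff_posSemidef.2 (sq_posSemidef ?_)
    refine Matrix.IsHermitian.sub ?_ ?_
    · rw [Matrix.IsHermitian, Matrix.conjTranspose_smul, hA.eq]; simp
    · rw [Matrix.IsHermitian, Matrix.conjTranspose_smul, hDh.eq]; simp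
  have hs : √ε * √ε = ε := Real.mul_self_sqrt hε.le
  have hs0 : √ε ≠ 0 := (Real.sqrt_pos.2 hε).ne'
  have h3 : (√ε • A - (√ε)⁻¹ • D) ^ 2 = ε • A ^ 2 + (1 / ε) • D ^ 2 - (A * D + D * A) := by
    have hs' : (√ε)⁻¹ * (√ε)⁻¹ = 1 / ε := by rw [← mul_inv, hs, one_div]
    simp only [sq, sub_mul, mul_sub, smul_mul_assoc, mul_smul_comm, smul_sub, smul_smul, hs, hs',
      mul_inv_cancel₀ hs0, inv_mul_cancel₀ hs0, one_smul]
    abel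
  rw [h3] at h2
  have h4 : 0 ≤ (1 + 1 / ε) • (algebraMap ℝ (Op L) (C ^ 2) - D ^ 2) :=
    smul_nonneg (by positivity) (sub_nonneg.2 h1)
  have h5 := smul_nonneg (show (0 : ℝ) ≤ 1 / 2 by norm_num) (add_nonneg h2 h4)
  rw [← sub_nonneg]
  convert h5 using 1
  rw [hBA]
  simp only [Algebra.algebraMap_eq_smul_one]
  have : (A + D) ^ 2 = A ^ 2 + (A * D + D * A) + D ^ 2 := by noncomm_ring
  rw [this]
  module

end GroundEnergy

/-! ### Jordan–Wigner strings and the Clifford relations. -/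

section TensorOp

variable {L : ℕ}

lemma tensorOp_mul (A B : Fin L → Matrix (Fin 2) (Fin 2) ℂ) :
    tensorOp A * tensorOp B = tensorOp fun i => A i * B i := by
  ext s t
  simp only [tensorOp, Matrix.mul_apply, Matrix.of_apply, ← Finset.prod_mul_distrib]
  rw [Finset.prod_univ_sum, Fintype.piFinset_univ]

lemma tensorOp_one : tensorOp (fun _ : Fin L => (1 : Matrix (Fin 2) (Fin 2) ℂ)) = 1 := by
  ext s t
  simp only [tensorOp, Matrix.of_apply, Matrix.one_apply]
  rw [Finset.prod_ite_zero]
  simp [funext_iff]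

lemma tensorOp_conjTranspose (A : Fin L → Matrix (Fin 2) (Fin 2) ℂ) :
    (tensorOp A).conjTranspose = tensorOp fun i => (A i).conjTranspose := by
  ext s t
  simp [tensorOp, Matrix.conjTranspose_apply]

/-- Tensor products that anticommute on exactly one site anticommute. -/
lemma tensorOp_anticomm {A B : Fin L → Matrix (Fin 2) (Fin 2) ℂ} (j : Fin L)
    (hj : A j * B j = -(B j * A j)) (h : ∀ i, i ≠ j → A i * B i = B i * A i) :
    tensorOp A * tensorOp B = -(tensorOp B * tensorOp A) := by
  rw [tensorOp_mul, tensorOp_mul]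
  ext s t
  simp only [tensorOp, Matrix.of_apply, Matrix.neg_apply]
  rw [Fintype.prod_eq_mul_prod_compl j, Fintype.prod_eq_mul_prod_compl j, hj, Matrix.neg_apply,
    neg_mul]
  congr 2
  refine Finset.prod_congr rfl fun i hi => ?_
  rw [h i (by simpa using hi)]

lemma pauliX_mul_self : pauliX * pauliX = 1 := by
  ext i j; fin_cases i <;> fin_cases j <;> simp [pauliX]

lemma pauliY_mul_self : pauliY * pauliY = 1 := by
  ext i j; fin_cases i <;> fin_cases j <;> simp [pauliY]

lemma pauliZ_mul_self : pauliZ * pauliZ = 1 := by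
  ext i j; fin_cases i <;> fin_cases j <;> simp [pauliZ]

lemma pauliX_mul_pauliY : pauliX * pauliY = -(pauliY * pauliX) := by
  ext i j; fin_cases i <;> fin_cases j <;> simp [pauliX, pauliY]

lemma pauliX_mul_pauliZ : pauliX * pauliZ = -(pauliZ * pauliX) := by
  ext i j; fin_cases i <;> fin_cases j <;> simp [pauliX, pauliZ]

lemma pauliY_mul_pauliZ : pauliY * pauliZ = -(pauliZ * pauliY) := by
  ext i j; fin_cases i <;> fin_cases j <;> simp [pauliY, pauliZ]

lemma pauliX_conjTranspose : pauliX.conjTranspose = pauliX := by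
  ext i j; fin_cases i <;> fin_cases j <;> simp [pauliX]

lemma pauliY_conjTranspose : pauliY.conjTranspose = pauliY := by
  ext i j; fin_cases i <;> fin_cases j <;> simp [pauliY]

lemma pauliZ_conjTranspose : pauliZ.conjTranspose = pauliZ := by
  ext i j; fin_cases i <;> fin_cases j <;> simp [pauliZ]

/-- The Jordan-Wigner operator with one-site part `S` at the site `j`. -/
def jordanWigner (S : Matrix (Fin 2) (Fin 2) ℂ) (j : Fin L) : Op L :=
  tensorOp fun i => if i < j then -pauliZ else if i = j then S else 1

lemma majoranaB_eq (j : Fin L) : majoranaB j = jordanWigner pauliX j := rfl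

lemma majoranaC_eq (j : Fin L) : majoranaC j = jordanWigner pauliY j := rfl

/-- The fermion parity `∏_i (-σᶻ_i)`. -/
def fermionParity (L : ℕ) : Op L := tensorOp fun _ => -pauliZ

lemma fermionParity_mul_self : fermionParity L * fermionParity L = 1 := by
  rw [fermionParity, tensorOp_mul]
  simp [pauliZ_mul_self, tensorOp_one]

lemma fermionParity_isHermitian : (fermionParity L).IsHermitian := by
  rw [Matrix.IsHermitian, fermionParity, tensorOp_conjTranspose]
  simp [pauliZ_conjTranspose]

lemma jordanWigner_mul_self {S : Matrix (Fin 2) (Fin 2) ℂ} (hS : S * S = 1) (j : Fin L) :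
    jordanWigner S j * jordanWigner S j = 1 := by
  rw [jordanWigner, tensorOp_mul, ← tensorOp_one]
  congr 1
  ext1 i
  split_ifs <;> simp [pauliZ_mul_self, hS]

lemma jordanWigner_isHermitian {S : Matrix (Fin 2) (Fin 2) ℂ} (hS : S.conjTranspose = S)
    (j : Fin L) : (jordanWigner S j).IsHermitian := by
  rw [Matrix.IsHermitian, jordanWigner, tensorOp_conjTranspose]
  congr 1
  ext1 i
  split_ifs <;> simp [pauliZ_conjTranspose, hS]

/-- The only anticommuting site is `j`, where `S` meets the string of `k`; below it both factors are
`-σᶻ`, above it the first is the identity. Hence `T` is arbitrary. -/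
lemma jordanWigner_anticomm_of_lt {S T : Matrix (Fin 2) (Fin 2) ℂ}
    (hS : S * pauliZ = -(pauliZ * S)) {j k : Fin L} (hjk : j < k) :
    jordanWigner S j * jordanWigner T k = -(jordanWigner T k * jordanWigner S j) := by
  refine tensorOp_anticomm j ?_ fun i hi => ?_
  · simp [hjk, hS]
  · rcases lt_or_gt_of_ne hi with h | h
    · simp [h, h.trans hjk]
    · simp [h.not_gt, hi]

lemma jordanWigner_anticomm_same {S T : Matrix (Fin 2) (Fin 2) ℂ} (h : S * T = -(T * S))
    (j : Fin L) : jordanWigner S j * jordanWigner T j = -(jordanWigner T j * jordanWigner S j) := by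
  refine tensorOp_anticomm j ?_ fun i hi => ?_
  · simp [h]
  · simp only [hi, if_false]

lemma fermionParity_anticomm_jordanWigner {S : Matrix (Fin 2) (Fin 2) ℂ}
    (hS : S * pauliZ = -(pauliZ * S)) (j : Fin L) :
    jordanWigner S j * fermionParity L = -(fermionParity L * jordanWigner S j) := by
  refine tensorOp_anticomm j ?_ fun i hi => ?_
  · simp [hS]
  · simp only [hi, if_false]
    split_ifs <;> simp

lemma majoranaB_mul_self (j : Fin L) : majoranaB j * majoranaB j = 1 :=
  jordanWigner_mul_self pauliX_mul_self j

lemma majoranaC_mul_self (j : Fin L) : majoranaC j * majoranaC j = 1 :=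
  jordanWigner_mul_self pauliY_mul_self j

lemma majoranaB_isHermitian (j : Fin L) : (majoranaB j).IsHermitian :=
  jordanWigner_isHermitian pauliX_conjTranspose j

lemma majoranaC_isHermitian (j : Fin L) : (majoranaC j).IsHermitian :=
  jordanWigner_isHermitian pauliY_conjTranspose j

lemma majoranaB_anticomm {j k : Fin L} (h : j ≠ k) :
    majoranaB j * majoranaB k = -(majoranaB k * majoranaB j) := by
  rcases lt_or_gt_of_ne h with h | h
  · exact jordanWigner_anticomm_of_lt pauliX_mul_pauliZ h
  · exact (neg_eq_iff_eq_neg.2 (jordanWigner_anticomm_of_lt pauliX_mul_pauliZ h)).symm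

lemma majoranaC_anticomm {j k : Fin L} (h : j ≠ k) :
    majoranaC j * majoranaC k = -(majoranaC k * majoranaC j) := by
  rcases lt_or_gt_of_ne h with h | h
  · exact jordanWigner_anticomm_of_lt pauliY_mul_pauliZ h
  · exact (neg_eq_iff_eq_neg.2 (jordanWigner_anticomm_of_lt pauliY_mul_pauliZ h)).symm

/-- Covers equal sites too, and so serves as a rewrite rule putting every `β` to the left of every
`γ`. -/
lemma majoranaC_mul_majoranaB (j k : Fin L) :
    majoranaC j * majoranaB k = -(majoranaB k * majoranaC j) := by
  rcases lt_trichotomy j k with h | rfl | h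
  · exact jordanWigner_anticomm_of_lt pauliY_mul_pauliZ h
  · exact (neg_eq_iff_eq_neg.2 (jordanWigner_anticomm_same pauliX_mul_pauliY j)).symm
  · exact (neg_eq_iff_eq_neg.2 (jordanWigner_anticomm_of_lt pauliX_mul_pauliZ h)).symm

lemma majoranaB_mul_fermionParity (j : Fin L) :
    majoranaB j * fermionParity L = -(fermionParity L * majoranaB j) :=
  fermionParity_anticomm_jordanWigner pauliX_mul_pauliZ j

lemma majoranaC_mul_fermionParity (j : Fin L) :
    majoranaC j * fermionParity L = -(fermionParity L * majoranaC j) :=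
  fermionParity_anticomm_jordanWigner pauliY_mul_pauliZ j

end TensorOp

noncomputable section

/-! ### Fourier modes of the critical Kitaev chain. -/

section Kitaev

variable {L : ℕ}

/-- Pairwise anticommuting nilpotent operators have a common kernel vector. -/
lemma exists_common_kernel {ι : Type*} (s : Finset ι) (f : ι → Op L)
    (h : ∀ i ∈ s, ∀ k ∈ s, f i * f k = -(f k * f i)) :
    ∃ v : Config L → ℂ, v ≠ 0 ∧ ∀ i ∈ s, (f i).mulVec v = 0 := by
  classical
  induction s using Finset.induction_on with
  | empty => exact ⟨fun _ => 1, fun h => one_ne_zero (congrFun h fun _ => 0), by simp⟩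
  | insert a s _ ih =>
    obtain ⟨v, hv, hs⟩ := ih fun i hi k hk =>
      h i (Finset.mem_insert_of_mem hi) k (Finset.mem_insert_of_mem hk)
    -- If `f a` does not already kill `v`, then `f a v` replaces `v`: nilpotency handles `f a`, and
    -- anticommutation preserves the kernels of the others.
    by_cases ha : (f a).mulVec v = 0
    · refine ⟨v, hv, fun i hi => ?_⟩
      rcases Finset.mem_insert.1 hi with rfl | hi
      exacts [ha, hs i hi]
    · refine ⟨(f a).mulVec v, ha, fun i hi => ?_⟩
      rcases Finset.mem_insert.1 hi with rfl | hi
      · have := h i (by simp) i (by simp)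
        -- The hypothesis on the diagonal says that the square equals its own negative.
        have h0 : f i * f i = 0 := by
          ext s t
          simpa using self_eq_neg.1 (congrFun (congrFun this s) t)
        rw [Matrix.mulVec_mulVec, h0, Matrix.zero_mulVec]
      · rw [Matrix.mulVec_mulVec, h i (Finset.mem_insert_of_mem hi) a (by simp),
          Matrix.neg_mulVec, ← Matrix.mulVec_mulVec, hs i hi, Matrix.mulVec_zero, neg_zero]

lemma majoranaB_anticommutator (j k : Fin L) :
    majoranaB j * majoranaB k + majoranaB k * majoranaB j = if j = k then 2 else 0 := by
  split_ifs with h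
  · subst h; rw [majoranaB_mul_self, one_add_one_eq_two]
  · rw [majoranaB_anticomm h, neg_add_cancel]

lemma majoranaC_anticommutator (j k : Fin L) :
    majoranaC j * majoranaC k + majoranaC k * majoranaC j = if j = k then 2 else 0 := by
  split_ifs with h
  · subst h; rw [majoranaC_mul_self, one_add_one_eq_two]
  · rw [majoranaC_anticomm h, neg_add_cancel]

lemma kitaevPBC_eq : kitaevPBC L = ∑ j : Fin L, (Complex.I • (majoranaB (next j) * majoranaC j) -
    Complex.I • (majoranaB j * majoranaC j)) := by
  rw [kitaevPBC, Finset.sum_sub_distrib, Finset.sum_sub_distrib]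
  congr 1
  exact Equiv.sum_comp (finRotate L).symm
    (fun j => Complex.I • (majoranaB j * majoranaC j : Op L))

lemma bilinear_isHermitian (j k : Fin L) :
    (Complex.I • (majoranaB j * majoranaC k)).IsHermitian := by
  rw [Matrix.IsHermitian, Matrix.conjTranspose_smul, Matrix.conjTranspose_mul,
    (majoranaB_isHermitian j).eq, (majoranaC_isHermitian k).eq, majoranaC_mul_majoranaB]
  simp

lemma isHermitian_sum {ι : Type*} (s : Finset ι) (f : ι → Op L)
    (h : ∀ i ∈ s, (f i).IsHermitian) : (∑ i ∈ s, f i).IsHermitian := by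
  rw [Matrix.IsHermitian, Matrix.conjTranspose_sum]
  exact Finset.sum_congr rfl fun i hi => (h i hi).eq

lemma kitaevPBC_isHermitian : (kitaevPBC L).IsHermitian := by
  rw [kitaevPBC_eq]
  exact isHermitian_sum _ _ fun j _ => (bilinear_isHermitian _ _).sub (bilinear_isHermitian _ _)

/-- The Bogoliubov mode with phase `w`. -/
def mode (L : ℕ) (w : ℂ) : Op L :=
  ∑ j : Fin L, (w ^ 2) ^ (j : ℕ) • (majoranaB j + w • majoranaC j)

/-- Mixed `βγ` terms cancel, and the local generators satisfy Clifford relations with constant `2(1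
+ ww')`; only a geometric series along the diagonal survives. -/
lemma mode_anticommutator (w w' : ℂ) :
    mode L w * mode L w' + mode L w' * mode L w =
      ((2 * (1 + w * w')) * ∑ j : Fin L, ((w * w') ^ 2) ^ (j : ℕ)) • (1 : Op L) := by
  have key (j k : Fin L) :
      (majoranaB j + w • majoranaC j) * (majoranaB k + w' • majoranaC k) +
      (majoranaB k + w' • majoranaC k) * (majoranaB j + w • majoranaC j) =
      if j = k then (2 * (1 + w * w')) • (1 : Op L) else 0 := by
    have h1 := majoranaB_anticommutator j k
    have h2 := majoranaC_anticommutator j k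
    have : (majoranaB j + w • majoranaC j) * (majoranaB k + w' • majoranaC k) +
      (majoranaB k + w' • majoranaC k) * (majoranaB j + w • majoranaC j) =
      (majoranaB j * majoranaB k + majoranaB k * majoranaB j) +
      (w * w') • (majoranaC j * majoranaC k + majoranaC k * majoranaC j) := by
      simp only [add_mul, mul_add, smul_mul_assoc, mul_smul_comm,
        majoranaC_mul_majoranaB j k, majoranaC_mul_majoranaB k j]
      module
    rw [this, h1, h2]
    split_ifs
    · rw [← one_add_one_eq_two (R := Op L)]
      module
    · simp
  have h2 : mode L w' * mode L w = ∑ j : Fin L, ∑ k : Fin L,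
      ((w ^ 2) ^ (j : ℕ) * (w' ^ 2) ^ (k : ℕ)) •
        ((majoranaB k + w' • majoranaC k) * (majoranaB j + w • majoranaC j)) := by
    rw [mode, mode, Finset.sum_mul_sum, Finset.sum_comm]
    simp only [smul_mul_smul_comm, mul_comm]
  have h1 : mode L w * mode L w' = ∑ j : Fin L, ∑ k : Fin L,
      ((w ^ 2) ^ (j : ℕ) * (w' ^ 2) ^ (k : ℕ)) •
        ((majoranaB j + w • majoranaC j) * (majoranaB k + w' • majoranaC k)) := by
    rw [mode, mode, Finset.sum_mul_sum]
    simp only [smul_mul_smul_comm]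
  rw [h1, h2, ← Finset.sum_add_distrib]
  simp only [← Finset.sum_add_distrib, ← smul_add, key, smul_ite, smul_zero,
    Finset.sum_ite_eq, Finset.mem_univ, if_true, smul_smul]
  rw [← Finset.sum_smul, Finset.mul_sum]
  congr 1
  refine Finset.sum_congr rfl fun j _ => ?_
  rw [mul_comm, mul_pow, mul_pow]

/-- The primitive `2 L`-th root of unity `exp (-iπ / L)`. -/
def phase (L : ℕ) : ℂ := (Complex.exp (2 * Real.pi * Complex.I / (2 * L : ℕ)))⁻¹

lemma phase_isPrimitiveRoot (hL : L ≠ 0) : IsPrimitiveRoot (phase L) (2 * L) :=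
  (Complex.isPrimitiveRoot_exp (2 * L) (by omega)).inv

lemma phase_ne_zero : phase L ≠ 0 := inv_ne_zero (Complex.exp_ne_zero _)

lemma phase_pow_eq (k : ℕ) :
    phase L ^ k = Complex.exp (((-(Real.pi * k / L) : ℝ) : ℂ) * Complex.I) := by
  rw [phase, ← Complex.exp_neg, ← Complex.exp_nat_mul]
  congr 1
  push_cast
  by_cases hL : (L : ℂ) = 0
  · simp [hL]
  · field_simp

lemma phase_pow_inv (k : ℕ) : star (phase L ^ k) = (phase L ^ k)⁻¹ := by
  rw [phase_pow_eq, Complex.star_def, ← Complex.exp_conj, ← Complex.exp_neg]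
  congr 1
  rw [map_mul, Complex.conj_ofReal, Complex.conj_I, mul_neg]

lemma phase_pow_self (hL : L ≠ 0) : phase L ^ L = -1 := by
  rw [phase_pow_eq, mul_div_assoc, div_self (by exact_mod_cast hL), mul_one]
  push_cast
  rw [neg_mul, Complex.exp_neg, Complex.exp_pi_mul_I]
  norm_num

/-- The case `k = l` is included and gives nilpotency. Positivity of `k` excludes the pair `(0, 0)`:
the zero mode does not square to zero. -/
lemma mode_phase_anticomm (hL : L ≠ 0) {k l : ℕ} (hk : 0 < k) (hkL : k < L) (hl : l < L) :
    mode L (phase L ^ k) * mode L (phase L ^ l) =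
      -(mode L (phase L ^ l) * mode L (phase L ^ k)) := by
  rw [eq_neg_iff_add_eq_zero, mode_anticommutator]
  convert zero_smul ℂ (1 : Op L)
  set q := phase L ^ k * phase L ^ l with hq
  have hq1 : q ≠ 1 := by
    rw [hq, ← pow_add]
    exact (phase_isPrimitiveRoot hL).pow_ne_one_of_pos_of_lt (by omega) (by omega)
  have hqL : (q ^ 2) ^ L = 1 := by
    rw [hq, ← pow_add, ← pow_mul, ← pow_mul,
      show (k + l) * (2 * L) = 2 * L * (k + l) by ring, pow_mul,
      (phase_isPrimitiveRoot hL).pow_eq_one, one_pow]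
  rw [Fin.sum_univ_eq_sum_range (fun j => (q ^ 2) ^ j)]
  -- With `q^(2L) = 1` this reads `(q - 1)(1 + q) ∑ q^(2j) = 0`. Cancelling only `q - 1` also treats
  -- `q = -1`, where the series itself does not vanish but the factor `1 + q` does.
  have h1 := mul_geom_sum (q ^ 2) L
  rw [hqL, sub_self, show q ^ 2 - 1 = (q - 1) * (1 + q) by ring, mul_assoc] at h1
  rw [mul_assoc, (mul_eq_zero.1 h1).resolve_left (sub_ne_zero.2 hq1), mul_zero]

/-- Orthogonality of the characters of the cyclic group of order `L`. -/
lemma sum_phase_orthogonality (hL : L ≠ 0) (a b : ℕ) :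
    ∑ k ∈ Finset.range L, ((phase L ^ k) ^ 2) ^ a / ((phase L ^ k) ^ 2) ^ b =
      if a ≡ b [MOD L] then (L : ℂ) else 0 := by
  have hω : IsPrimitiveRoot (phase L ^ 2) L :=
    (phase_isPrimitiveRoot hL).pow (by omega) rfl
  have hω0 : phase L ^ 2 ≠ 0 := pow_ne_zero _ phase_ne_zero
  set ω := phase L ^ 2
  have h1 (k : ℕ) : ((phase L ^ k) ^ 2) ^ a / ((phase L ^ k) ^ 2) ^ b = (ω ^ a / ω ^ b) ^ k := by
    rw [div_pow]
    congr 1 <;> simp only [ω, ← pow_mul] <;> congr 1 <;> ring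
  simp only [h1]
  have hmod : a ≡ b [MOD L] ↔ ω ^ a = ω ^ b := by
    have := IsUnit.mk0 ω hω0
    conv_lhs => rw [hω.eq_orderOf]
    obtain ⟨u, hu⟩ := this
    rw [← hu, orderOf_units, ← pow_eq_pow_iff_modEq]
    simp [Units.ext_iff]
  split_ifs with h
  · rw [hmod.1 h, div_self (pow_ne_zero _ hω0)]
    simp
  · have h2 := mul_geom_sum (ω ^ a / ω ^ b) L
    have h3 : (ω ^ a / ω ^ b) ^ L = 1 := by
      rw [div_pow, pow_right_comm, pow_right_comm ω b, hω.pow_eq_one]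
      simp
    rw [h3, sub_self] at h2
    refine (mul_eq_zero.1 h2).resolve_left (sub_ne_zero.2 fun h4 => h (hmod.2 ?_))
    exact (div_eq_one_iff_eq (pow_ne_zero _ hω0)).1 h4

lemma next_val_modEq (j : Fin L) : (next j : ℕ) ≡ j + 1 [MOD L] := by
  obtain _ | n := L
  · exact j.elim0
  · rw [next, finRotate_apply, Nat.ModEq, Fin.val_add]
    simp

lemma fin_modEq_iff (j k : Fin L) : (j : ℕ) ≡ k [MOD L] ↔ j = k := by
  rw [Nat.ModEq, Nat.mod_eq_of_lt j.2, Nat.mod_eq_of_lt k.2, Fin.ext_iff]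

/-- The single-particle energy `2 sin θ` of the mode with phase `w = exp (-iθ)`. -/
def modeEnergy (w : ℂ) : ℂ := Complex.I * (w - w⁻¹)

lemma modeEnergy_phase (k : ℕ) :
    modeEnergy (phase L ^ k) = ((2 * Real.sin (Real.pi * k / L) : ℝ) : ℂ) := by
  rw [modeEnergy, ← phase_pow_inv, phase_pow_eq, Complex.star_def, ← Complex.exp_conj, map_mul,
    Complex.conj_ofReal, Complex.conj_I, mul_neg, ← neg_mul]
  rw [Complex.ofReal_neg, neg_neg]
  push_cast
  rw [Complex.sin]
  ring_nf

end Kitaev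

end

/-! ### Exact ground-state energy of the critical Kitaev chain. -/

section KitaevSpectrum

variable {L : ℕ}

lemma mode_conjTranspose_mul {w : ℂ} (hw1 : w ≠ 0) (hw : star w = w⁻¹) :
    (mode L w).conjTranspose * mode L w = ∑ j : Fin L, ∑ l : Fin L,
      ((w ^ 2) ^ (l : ℕ) / (w ^ 2) ^ (j : ℕ)) •
        ((majoranaB j * majoranaB l + majoranaC j * majoranaC l) +
          w • (majoranaB j * majoranaC l) + w⁻¹ • (majoranaC j * majoranaB l)) := by
  have h1 : (mode L w).conjTranspose =
      ∑ j : Fin L, ((w ^ 2) ^ (j : ℕ))⁻¹ • (majoranaB j + w⁻¹ • majoranaC j) := by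
    rw [mode, Matrix.conjTranspose_sum]
    refine Finset.sum_congr rfl fun j _ => ?_
    rw [Matrix.conjTranspose_smul, Matrix.conjTranspose_add, Matrix.conjTranspose_smul,
      (majoranaB_isHermitian j).eq, (majoranaC_isHermitian j).eq, star_pow, star_pow, hw, inv_pow,
      inv_pow]
  rw [h1, mode, Finset.sum_mul_sum]
  refine Finset.sum_congr rfl fun j _ => Finset.sum_congr rfl fun l _ => ?_
  rw [smul_mul_smul_comm, ← div_eq_inv_mul]
  congr 1
  simp only [add_mul, mul_add, smul_mul_assoc, mul_smul_comm, smul_add, smul_smul, mul_inv_cancel₀ hw1,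
    one_smul]
  abel

lemma modeEnergy_neg_inv (w : ℂ) : modeEnergy (-w⁻¹) = modeEnergy w := by
  rw [modeEnergy, modeEnergy, inv_neg, inv_inv]
  ring

/-- The Fourier coefficients of the single-particle energies are even. -/
lemma energy_sum_symm (hL : L ≠ 0) (j l : ℕ) :
    ∑ k ∈ Finset.range L, modeEnergy (phase L ^ k) *
        (((phase L ^ k) ^ 2) ^ l / ((phase L ^ k) ^ 2) ^ j) =
      ∑ k ∈ Finset.range L, modeEnergy (phase L ^ k) *
        (((phase L ^ k) ^ 2) ^ j / ((phase L ^ k) ^ 2) ^ l) := by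
  -- The vanishing term `k = L` makes the index range invariant under `k ↦ L - k`, which sends `w`
  -- to `-w⁻¹`: the energy is kept and the powers of `w²` are inverted.
  have h0 : modeEnergy (phase L ^ L) = 0 := by
    rw [phase_pow_self hL, modeEnergy]; norm_num
  have hext (j l : ℕ) : ∑ k ∈ Finset.range L, modeEnergy (phase L ^ k) *
        (((phase L ^ k) ^ 2) ^ l / ((phase L ^ k) ^ 2) ^ j) =
      ∑ k ∈ Finset.range (L + 1), modeEnergy (phase L ^ k) *
        (((phase L ^ k) ^ 2) ^ l / ((phase L ^ k) ^ 2) ^ j) := by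
    rw [Finset.sum_range_succ, h0, zero_mul, add_zero]
  rw [hext, hext, ← Finset.sum_flip]
  refine Finset.sum_congr rfl fun k hk => ?_
  have hk : k ≤ L := Nat.lt_succ_iff.1 (Finset.mem_range.1 hk)
  have h1 : phase L ^ (L - k) = -(phase L ^ k)⁻¹ := by
    rw [pow_sub₀ _ phase_ne_zero hk, phase_pow_self hL, neg_one_mul]
  rw [h1, modeEnergy_neg_inv, neg_sq, inv_pow, inv_pow, inv_pow, inv_div_inv]

/-- Because `ε(w) w = i(w² - 1)`, the sum is a difference of two character sums: one gives the bond,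
the other the on-site term. -/
lemma energy_sum_phase (hL : L ≠ 0) (j l : Fin L) :
    ∑ k ∈ Finset.range L, modeEnergy (phase L ^ k) *
        (((phase L ^ k) ^ 2) ^ (l : ℕ) / ((phase L ^ k) ^ 2) ^ (j : ℕ)) * phase L ^ k =
      Complex.I * ((if next l = j then (L : ℂ) else 0) - if l = j then (L : ℂ) else 0) := by
  have h1 := sum_phase_orthogonality hL (l + 1) j
  have h2 := sum_phase_orthogonality hL l j
  have e1 : (l + 1 : ℕ) ≡ j [MOD L] ↔ next l = j := by
    rw [← fin_modEq_iff]
    exact ⟨fun h => (next_val_modEq l).trans h, fun h => (next_val_modEq l).symm.trans h⟩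
  simp only [e1] at h1
  simp only [fin_modEq_iff] at h2
  rw [← h1, ← h2, ← Finset.sum_sub_distrib, Finset.mul_sum]
  refine Finset.sum_congr rfl fun k _ => ?_
  have : phase L ^ k ≠ 0 := pow_ne_zero _ phase_ne_zero
  rw [modeEnergy, pow_succ _ (l : ℕ)]
  field_simp

/-- Same mechanism, now with `ε(w) w⁻¹ = i(1 - w⁻²)`. -/
lemma energy_sum_phase_inv (hL : L ≠ 0) (j l : Fin L) :
    ∑ k ∈ Finset.range L, modeEnergy (phase L ^ k) *
        (((phase L ^ k) ^ 2) ^ (l : ℕ) / ((phase L ^ k) ^ 2) ^ (j : ℕ)) * (phase L ^ k)⁻¹ =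
      Complex.I * ((if l = j then (L : ℂ) else 0) - if l = next j then (L : ℂ) else 0) := by
  have h1 := sum_phase_orthogonality hL l (j + 1)
  have h2 := sum_phase_orthogonality hL l j
  have e1 : (l : ℕ) ≡ j + 1 [MOD L] ↔ l = next j := by
    rw [← fin_modEq_iff]
    exact ⟨fun h => h.trans (next_val_modEq j).symm, fun h => h.trans (next_val_modEq j)⟩
  simp only [e1] at h1
  simp only [fin_modEq_iff] at h2
  rw [← h1, ← h2, ← Finset.sum_sub_distrib, Finset.mul_sum]
  refine Finset.sum_congr rfl fun k _ => ?_
  have : phase L ^ k ≠ 0 := pow_ne_zero _ phase_ne_zero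
  rw [modeEnergy, pow_succ _ (j : ℕ)]
  field_simp

/-- A symmetric quadratic form in the generators of a Clifford algebra is its trace. -/
lemma clifford_symmetric_sum (b : Fin L → Op L)
    (hb : ∀ j l, b j * b l + b l * b j = if j = l then 2 else 0) (F : Fin L → Fin L → ℂ)
    (hF : ∀ j l, F j l = F l j) :
    ∑ j, ∑ l, F j l • (b j * b l) = (∑ j, F j j) • (1 : Op L) := by
  have h1 : ∑ j, ∑ l, F j l • (b j * b l) = ∑ j, ∑ l, F j l • (b l * b j) := by
    rw [Finset.sum_comm]
    exact Finset.sum_congr rfl fun j _ => Finset.sum_congr rfl fun l _ => by rw [hF]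
  have h2 : (2 : ℂ) • ∑ j, ∑ l, F j l • (b j * b l) = (2 : ℂ) • (∑ j, F j j) • (1 : Op L) := by
    rw [two_smul]
    nth_rewrite 2 [h1]
    simp only [← Finset.sum_add_distrib, ← smul_add, hb, smul_ite, smul_zero, Finset.sum_ite_eq,
      Finset.mem_univ, if_true]
    rw [← one_add_one_eq_two (R := Op L), ← Finset.sum_smul]
    module
  exact smul_right_injective _ (two_ne_zero (α := ℂ)) h2

/-- The critical Kitaev chain in diagonal form. -/
lemma kitaevPBC_diagonal (hL : L ≠ 0) :
    ∑ k ∈ Finset.range L, modeEnergy (phase L ^ k) •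
        ((mode L (phase L ^ k)).conjTranspose * mode L (phase L ^ k)) =
      (2 * L : ℂ) • (kitaevPBC L +
        (∑ k ∈ Finset.range L, modeEnergy (phase L ^ k)) • (1 : Op L)) := by
  have h1 : ∑ k ∈ Finset.range L, modeEnergy (phase L ^ k) •
        ((mode L (phase L ^ k)).conjTranspose * mode L (phase L ^ k)) =
      ∑ j : Fin L, ∑ l : Fin L,
        ((∑ k ∈ Finset.range L, modeEnergy (phase L ^ k) *
          (((phase L ^ k) ^ 2) ^ (l : ℕ) / ((phase L ^ k) ^ 2) ^ (j : ℕ))) •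
            (majoranaB j * majoranaB l) +
        (∑ k ∈ Finset.range L, modeEnergy (phase L ^ k) *
          (((phase L ^ k) ^ 2) ^ (l : ℕ) / ((phase L ^ k) ^ 2) ^ (j : ℕ))) •
            (majoranaC j * majoranaC l) +
        (∑ k ∈ Finset.range L, modeEnergy (phase L ^ k) *
          (((phase L ^ k) ^ 2) ^ (l : ℕ) / ((phase L ^ k) ^ 2) ^ (j : ℕ)) * phase L ^ k) •
            (majoranaB j * majoranaC l) +
        (∑ k ∈ Finset.range L, modeEnergy (phase L ^ k) *
          (((phase L ^ k) ^ 2) ^ (l : ℕ) / ((phase L ^ k) ^ 2) ^ (j : ℕ)) * (phase L ^ k)⁻¹) •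
            (majoranaC j * majoranaB l)) := by
    have hm (k : ℕ) := mode_conjTranspose_mul (L := L) (w := phase L ^ k)
      (pow_ne_zero k phase_ne_zero) (phase_pow_inv k)
    simp only [Finset.sum_smul, ← Finset.sum_add_distrib, hm, Finset.smul_sum]
    rw [Finset.sum_comm]
    refine Finset.sum_congr rfl fun j _ => ?_
    rw [Finset.sum_comm]
    refine Finset.sum_congr rfl fun l _ => Finset.sum_congr rfl fun k _ => ?_
    module
  rw [h1]
  simp only [Finset.sum_add_distrib]
  -- Evenness of the Fourier coefficients collapses the `ββ` and `γγ` parts to scalars, `L S` each;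
  -- below, the `βγ` and `γβ` parts contribute `L H_CTI` each.
  rw [clifford_symmetric_sum _ majoranaB_anticommutator _ fun j l => energy_sum_symm hL j l,
    clifford_symmetric_sum _ majoranaC_anticommutator _ fun j l => energy_sum_symm hL j l]
  simp only [energy_sum_phase hL, energy_sum_phase_inv hL]
  have h2 : ∑ j : Fin L, ∑ k ∈ Finset.range L, modeEnergy (phase L ^ k) *
      (((phase L ^ k) ^ 2) ^ (j : ℕ) / ((phase L ^ k) ^ 2) ^ (j : ℕ)) =
      L * ∑ k ∈ Finset.range L, modeEnergy (phase L ^ k) := by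
    have (j k : ℕ) : ((phase L ^ k) ^ 2) ^ j / ((phase L ^ k) ^ 2) ^ j = 1 :=
      div_self (pow_ne_zero _ (pow_ne_zero _ (pow_ne_zero _ phase_ne_zero)))
    simp [this]
  have h3 : ∑ j : Fin L, ∑ l : Fin L, (Complex.I * ((if next l = j then (L : ℂ) else 0) -
      if l = j then (L : ℂ) else 0)) • (majoranaB j * majoranaC l) = (L : ℂ) • kitaevPBC L := by
    rw [Finset.sum_comm, kitaevPBC_eq, Finset.smul_sum]
    refine Finset.sum_congr rfl fun l _ => ?_
    simp only [mul_sub, sub_smul, Finset.sum_sub_distrib, mul_ite, mul_zero, ite_smul, zero_smul,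
      Finset.sum_ite_eq, Finset.mem_univ, if_true]
    module
  have h4 : ∑ j : Fin L, ∑ l : Fin L, (Complex.I * ((if l = j then (L : ℂ) else 0) -
      if l = next j then (L : ℂ) else 0)) • (majoranaC j * majoranaB l) =
      (L : ℂ) • kitaevPBC L := by
    rw [kitaevPBC_eq, Finset.smul_sum]
    refine Finset.sum_congr rfl fun l _ => ?_
    simp only [mul_sub, sub_smul, Finset.sum_sub_distrib, mul_ite, mul_zero, ite_smul, zero_smul,
      Finset.sum_ite_eq', Finset.mem_univ, if_true, majoranaC_mul_majoranaB]
    module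
  rw [h2, h3, h4]
  module

/-- Multiplication by `sin(π/2L)` makes the sum telescope through the product-to-sum formula. -/
lemma sum_modeEnergy (hL : L ≠ 0) :
    ∑ k ∈ Finset.range L, 2 * Real.sin (Real.pi * k / L) =
      2 * Real.cos (Real.pi / (2 * L)) / Real.sin (Real.pi / (2 * L)) := by
  have hL0 : (0 : ℝ) < L := by positivity
  have hL1 : (1 : ℝ) ≤ L := by exact_mod_cast Nat.one_le_iff_ne_zero.2 hL
  set h := Real.pi / (2 * L) with hh
  have hs : 0 < Real.sin h := by
    apply Real.sin_pos_of_pos_of_lt_pi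
    · positivity
    · rw [hh, div_lt_iff₀ (by positivity)]
      nlinarith [Real.pi_pos]
  have hpi : Real.pi = 2 * L * h := by rw [hh]; field_simp
  rw [eq_div_iff hs.ne', Finset.sum_mul]
  have h1 (k : ℕ) : 2 * Real.sin (Real.pi * k / L) * Real.sin h =
      -Real.cos ((2 * (k + 1 : ℕ) - 1) * h) - -Real.cos ((2 * k - 1) * h) := by
    have e1 : Real.pi * k / L = 2 * k * h := by rw [hh]; field_simp
    rw [e1]
    have e2 : (2 * ((k + 1 : ℕ) : ℝ) - 1) * h = 2 * k * h + h := by push_cast; ring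
    have e3 : (2 * (k : ℝ) - 1) * h = 2 * k * h - h := by ring
    rw [e2, e3, Real.cos_add, Real.cos_sub]
    ring
  simp only [h1]
  rw [Finset.sum_range_sub (fun k : ℕ => -Real.cos ((2 * (k : ℝ) - 1) * h))]
  have e4 : (2 * (L : ℝ) - 1) * h = Real.pi - h := by rw [hpi]; ring
  have e5 : (2 * ((0 : ℕ) : ℝ) - 1) * h = -h := by push_cast; ring
  rw [e4, e5, Real.cos_pi_sub, Real.cos_neg]
  ring

lemma groundEnergy_kitaevPBC (hL : L ≠ 0) :
    groundEnergy (kitaevPBC L) = -∑ k ∈ Finset.range L, 2 * Real.sin (Real.pi * k / L) := by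
  have hd := kitaevPBC_diagonal hL
  set S := ∑ k ∈ Finset.range L, 2 * Real.sin (Real.pi * k / L) with hS
  have hSc : ∑ k ∈ Finset.range L, modeEnergy (phase L ^ k) = (S : ℂ) := by
    rw [hS, Complex.ofReal_sum]
    exact Finset.sum_congr rfl fun k _ => modeEnergy_phase k
  rw [hSc] at hd
  have hL0 : (2 * L : ℂ) ≠ 0 := by exact_mod_cast (by omega : 2 * L ≠ 0)
  apply le_antisymm
  -- The mode `k = 0` is left out: it is not nilpotent, but its energy is zero, so it need not
  -- annihilate the ground state.
  · obtain ⟨v, hv, hk⟩ := exists_common_kernel (L := L) (Finset.Ioo 0 L)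
      (fun k => mode L (phase L ^ k)) fun i hi k hk =>
        mode_phase_anticomm hL (Finset.mem_Ioo.1 hi).1 (Finset.mem_Ioo.1 hi).2
          (Finset.mem_Ioo.1 hk).2
    refine groundEnergy_le_of_eigenvector kitaevPBC_isHermitian hv ?_
    have h1 := congrArg (fun M => Matrix.mulVec M v) hd
    simp only [Matrix.sum_mulVec, Matrix.smul_mulVec, Matrix.add_mulVec,
      Matrix.one_mulVec] at h1
    rw [Finset.sum_eq_zero] at h1
    · have h2 := (smul_eq_zero.1 h1.symm).resolve_left hL0
      rw [eq_neg_of_add_eq_zero_left h2]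
      push_cast
      rw [neg_smul]
    · intro k hkL
      rcases Nat.eq_zero_or_pos k with rfl | hpos
      · simp [modeEnergy]
      · rw [← Matrix.mulVec_mulVec, hk k (Finset.mem_Ioo.2 ⟨hpos, Finset.mem_range.1 hkL⟩),
          Matrix.mulVec_zero, smul_zero]
  · rw [← algebraMap_le_iff_le_groundEnergy kitaevPBC_isHermitian, ← sub_nonneg]
    have h1 : (0 : Op L) ≤ ∑ k ∈ Finset.range L, modeEnergy (phase L ^ k) •
        ((mode L (phase L ^ k)).conjTranspose * mode L (phase L ^ k)) := by
      refine Finset.sum_nonneg fun k hk => ?_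
      rw [modeEnergy_phase, Complex.coe_smul]
      refine smul_nonneg (mul_nonneg two_pos.le (Real.sin_nonneg_of_nonneg_of_le_pi ?_ ?_))
        (Matrix.nonneg_iff_posSemidef.2 (Matrix.posSemidef_conjTranspose_mul_self _))
      · positivity
      · have : (k : ℝ) ≤ L := by exact_mod_cast (Finset.mem_range.1 hk).le
        rw [div_le_iff₀ (by positivity)]
        exact mul_le_mul_of_nonneg_left this Real.pi_pos.le
    rw [hd] at h1
    have h2 := smul_nonneg (show (0 : ℝ) ≤ (2 * L : ℝ)⁻¹ by positivity) h1
    convert h2 using 1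
    rw [Algebra.algebraMap_eq_smul_one, neg_smul, sub_neg_eq_add, ← Complex.coe_smul,
      ← Complex.coe_smul, smul_smul]
    push_cast
    rw [inv_mul_cancel₀ hL0, one_smul]

lemma tendsto_groundEnergy_kitaevPBC :
    Tendsto (fun L : ℕ => groundEnergy (kitaevPBC L) / (L : ℝ)) atTop (𝓝 (-(4 / Real.pi))) := by
  have hh : Tendsto (fun L : ℕ => Real.pi / 2 / (L : ℝ)) atTop (𝓝 0) :=
    tendsto_const_div_atTop_nhds_zero_nat _
  have h1 := (Real.continuous_cos.tendsto 0).comp hh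
  -- With `h = π/(2L)`, `S/L = (4/π) cos h / sinc h`, and both functions are continuous at `0`.
  have h2 := (Real.continuous_sinc.tendsto 0).comp hh
  rw [Real.cos_zero] at h1
  rw [Real.sinc_zero] at h2
  have h3 := ((h1.div h2 one_ne_zero).const_mul (4 / Real.pi)).neg
  rw [div_one, mul_one] at h3
  refine h3.congr' ?_
  filter_upwards [eventually_ne_atTop 0] with L hL
  have hL0 : (L : ℝ) ≠ 0 := by exact_mod_cast hL
  rw [groundEnergy_kitaevPBC hL, sum_modeEnergy hL]
  have e : Real.pi / (2 * L) = Real.pi / 2 / L := by field_simp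
  have hne : Real.pi / 2 / (L : ℝ) ≠ 0 := by positivity
  simp only [Function.comp, Pi.div_apply, Real.sinc_of_ne_zero hne, e]
  field_simp
  ring

end KitaevSpectrum

/-! ### Expansion of the Hamiltonian, its lower bound, and the zero mode at `α = 1/2`. -/

section Supercharge

variable {L : ℕ}

lemma next_val_of_lt {j : Fin L} (h : j.val + 1 < L) : (next j).val = j.val + 1 := by
  have := next_val_modEq j
  rw [Nat.ModEq, Nat.mod_eq_of_lt (next j).2, Nat.mod_eq_of_lt h] at this
  exact this

lemma next_ne_of_lt {j : Fin L} (h : j.val + 1 < L) : next j ≠ j := fun h' => by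
  have := next_val_of_lt h
  rw [h'] at this
  omega

/-- Here `2 ≤ L` enters: a cubic term is Hermitian with square one because its three Majoranas are
distinct. -/
lemma next_ne (hL : 2 ≤ L) (j : Fin L) : next j ≠ j := by
  by_cases h : j.val + 1 < L
  · exact next_ne_of_lt h
  · intro h'
    have := next_val_modEq j
    rw [h', show j.val + 1 = L by omega, Nat.ModEq, Nat.mod_self, Nat.mod_eq_of_lt j.2] at this
    omega

lemma majoranaB_anticommutator_cubic (k a b : Fin L) :
    majoranaB k * (majoranaB a * majoranaB b * majoranaC a) +
      (majoranaB a * majoranaB b * majoranaC a) * majoranaB k =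
    (if k = a then 2 else 0) * (majoranaB b * majoranaC a) -
      (if k = b then 2 else 0) * (majoranaB a * majoranaC a) := by
  have h1 := majoranaB_anticommutator k a
  have h2 := majoranaB_anticommutator k b
  have h3 := majoranaC_mul_majoranaB a k
  rw [← h1, ← h2]
  -- An anticommutator of generators is a scalar, so it moves past `β_a`; the rest is the graded
  -- Leibniz rule.
  have h2c : (majoranaB k * majoranaB b + majoranaB b * majoranaB k) * majoranaB a =
      majoranaB a * (majoranaB k * majoranaB b + majoranaB b * majoranaB k) := by
    rw [h2]; split_ifs
    · rw [← one_add_one_eq_two (R := Op L), add_mul, mul_add, one_mul, mul_one]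
    · simp
  calc _ = majoranaB k * (majoranaB a * majoranaB b * majoranaC a) +
      majoranaB a * majoranaB b * (majoranaC a * majoranaB k) := by simp only [mul_assoc]
    _ = (majoranaB k * majoranaB a + majoranaB a * majoranaB k) * (majoranaB b * majoranaC a) -
      (majoranaB a * (majoranaB k * majoranaB b + majoranaB b * majoranaB k)) * majoranaC a := by
        rw [h3]; noncomm_ring
    _ = _ := by rw [← h2c, mul_assoc]

/-- Used twice: summed over `j` it produces the Kitaev chain, and for a single `j` it bounds the
cost of cutting a bond. -/
lemma sum_majoranaB_anticommutator_cubicTerm (j : Fin L) :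
    (∑ k, majoranaB k) * cubicTerm j + cubicTerm j * (∑ k, majoranaB k) =
      (2 : ℝ) • (Complex.I • (majoranaB (next j) * majoranaC j) -
        Complex.I • (majoranaB j * majoranaC j)) := by
  rw [Finset.sum_mul, Finset.mul_sum, ← Finset.sum_add_distrib]
  simp only [cubicTerm, mul_smul_comm, smul_mul_assoc, ← smul_add,
    majoranaB_anticommutator_cubic]
  rw [← Finset.smul_sum, Finset.sum_sub_distrib]
  simp only [ite_mul, zero_mul, Finset.sum_ite_eq', Finset.mem_univ, if_true]
  rw [← one_add_one_eq_two (R := Op L), add_mul, add_mul, one_mul, one_mul]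
  module

lemma cubicTerm_isHermitian {j : Fin L} (h : next j ≠ j) : (cubicTerm j).IsHermitian := by
  rw [Matrix.IsHermitian, cubicTerm, Matrix.conjTranspose_smul, Matrix.conjTranspose_mul,
    Matrix.conjTranspose_mul, (majoranaB_isHermitian _).eq, (majoranaB_isHermitian _).eq,
    (majoranaC_isHermitian _).eq, ← mul_assoc, majoranaC_mul_majoranaB, neg_mul, mul_assoc,
    majoranaC_mul_majoranaB, mul_neg, neg_neg, ← mul_assoc, majoranaB_anticomm h]
  simp

lemma cubicTerm_mul_self {j : Fin L} (h : next j ≠ j) : cubicTerm j * cubicTerm j = 1 := by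
  nth_rewrite 1 [← (cubicTerm_isHermitian h).eq]
  rw [cubicTerm, Matrix.conjTranspose_smul, Matrix.conjTranspose_mul, Matrix.conjTranspose_mul,
    (majoranaB_isHermitian _).eq, (majoranaB_isHermitian _).eq, (majoranaC_isHermitian _).eq,
    smul_mul_smul_comm]
  have : majoranaC j * (majoranaB (next j) * majoranaB j) *
      (majoranaB j * majoranaB (next j) * majoranaC j) = majoranaC j * (majoranaB (next j) *
      ((majoranaB j * majoranaB j) * majoranaB (next j))) * majoranaC j := by
    simp only [mul_assoc]
  rw [this, majoranaB_mul_self, one_mul, majoranaB_mul_self, mul_one, majoranaC_mul_self]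
  simp

lemma real_smul_isHermitian {A : Op L} (hA : A.IsHermitian) (c : ℝ) : (c • A).IsHermitian := by
  rw [Matrix.IsHermitian, Matrix.conjTranspose_smul, hA.eq]
  simp

lemma superchargePBC_eq (α : ℝ) : superchargePBC L α =
    (1 - α) • (∑ j : Fin L, majoranaB j) + α • (∑ j : Fin L, cubicTerm j) := by
  rw [superchargePBC, Finset.sum_add_distrib, Finset.smul_sum, Finset.smul_sum]

lemma sum_cubicTerm_isHermitian (hL : 2 ≤ L) : (∑ j : Fin L, cubicTerm j).IsHermitian :=
  isHermitian_sum _ _ fun j _ => cubicTerm_isHermitian (next_ne hL j)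

lemma sum_majoranaB_isHermitian (s : Finset (Fin L)) : (∑ j ∈ s, majoranaB j).IsHermitian :=
  isHermitian_sum _ _ fun j _ => majoranaB_isHermitian j

lemma superchargePBC_isHermitian (hL : 2 ≤ L) (α : ℝ) : (superchargePBC L α).IsHermitian := by
  rw [superchargePBC_eq]
  exact (real_smul_isHermitian (sum_majoranaB_isHermitian _) _).add
    (real_smul_isHermitian (sum_cubicTerm_isHermitian hL) _)

lemma hamiltonianPBC_isHermitian (hL : 2 ≤ L) (α : ℝ) : (hamiltonianPBC L α).IsHermitian :=
  half_sq_isHermitian (superchargePBC_isHermitian hL α)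

lemma interactionPBC_posSemidef (hL : 2 ≤ L) : (interactionPBC L).PosSemidef :=
  Matrix.nonneg_iff_posSemidef.1 <| smul_nonneg (by norm_num)
    (Matrix.nonneg_iff_posSemidef.2 (sq_posSemidef (sum_cubicTerm_isHermitian hL)))

lemma sum_majoranaB_sq : (∑ j : Fin L, majoranaB j) ^ 2 = (L : ℝ) • (1 : Op L) := by
  have := clifford_symmetric_sum (L := L) _ majoranaB_anticommutator (fun _ _ => 1) fun _ _ => rfl
  simp only [one_smul] at this
  rw [sq, Finset.sum_mul_sum, this, ← Complex.coe_smul]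
  simp

/-- The Hamiltonian as a mixture of the critical Kitaev chain and the interaction. -/
lemma hamiltonianPBC_eq (α : ℝ) : hamiltonianPBC L α =
    algebraMap ℝ (Op L) ((1 - α) ^ 2 * L / 2) + (α * (1 - α)) • kitaevPBC L +
      α ^ 2 • interactionPBC L := by
  have h1 : (∑ k : Fin L, majoranaB k) * (∑ j : Fin L, cubicTerm j) +
      (∑ j : Fin L, cubicTerm j) * (∑ k : Fin L, majoranaB k) = (2 : ℝ) • kitaevPBC L := by
    rw [Finset.mul_sum, Finset.sum_mul, ← Finset.sum_add_distrib, kitaevPBC_eq, Finset.smul_sum]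
    exact Finset.sum_congr rfl fun j _ => sum_majoranaB_anticommutator_cubicTerm j
  rw [hamiltonianPBC, superchargePBC_eq, interactionPBC, Algebra.algebraMap_eq_smul_one]
  have h2 := sum_majoranaB_sq (L := L)
  set B : Op L := ∑ k : Fin L, majoranaB k
  set C : Op L := ∑ j : Fin L, cubicTerm j
  have h3 : ((1 - α) • B + α • C) ^ 2 =
      (1 - α) ^ 2 • B ^ 2 + (α * (1 - α)) • (B * C + C * B) + α ^ 2 • C ^ 2 := by
    simp only [sq, add_mul, mul_add, smul_mul_assoc, mul_smul_comm, smul_add, smul_smul]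
    module
  rw [h3, h1, h2]
  module

/-- The non-negative interaction is dropped; `0 ≤ α ≤ 1` makes the coefficient of the Kitaev chain
non-negative. -/
lemma le_groundEnergy_hamiltonianPBC (hL : 2 ≤ L) {α : ℝ} (hα : α ∈ Set.Icc (0 : ℝ) 1) :
    (1 - α) ^ 2 * L / 2 + α * (1 - α) * groundEnergy (kitaevPBC L) ≤
      groundEnergy (hamiltonianPBC L α) := by
  rw [← algebraMap_le_iff_le_groundEnergy (hamiltonianPBC_isHermitian hL α), hamiltonianPBC_eq,
    map_add]
  have h1 := (algebraMap_le_iff_le_groundEnergy (kitaevPBC_isHermitian (L := L))).2 le_rfl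
  have h2 : algebraMap ℝ (Op L) (α * (1 - α) * groundEnergy (kitaevPBC L)) ≤
      (α * (1 - α)) • kitaevPBC L := by
    rw [map_mul, ← Algebra.smul_def]
    exact smul_le_smul_of_nonneg_left h1 (mul_nonneg hα.1 (sub_nonneg.2 hα.2))
  refine (add_le_add_right h2 _).trans (le_add_of_nonneg_right ?_)
  exact smul_nonneg (sq_nonneg _) (Matrix.nonneg_iff_posSemidef.2 (interactionPBC_posSemidef hL))

/-- At `α = 1/2` the Fock vacuum is annihilated by the supercharge. -/
lemma groundEnergy_hamiltonianPBC_half (hL : 2 ≤ L) :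
    groundEnergy (hamiltonianPBC L (1 / 2)) = 0 := by
  have hR := superchargePBC_isHermitian hL (1 / 2)
  refine le_antisymm ?_ (groundEnergy_half_sq_nonneg hR)
  -- The operators `β_j - i γ_j` anticommute because `β` and `γ` obey the same relations and `i² =
  -- -1`. On their common kernel `i γ_j` acts as `β_j`.
  obtain ⟨v, hv, hk⟩ := exists_common_kernel (L := L) Finset.univ
    (fun j => majoranaB j - Complex.I • majoranaC j) fun i _ k _ => by
      have h1 := majoranaB_anticommutator i k
      have h2 := majoranaC_anticommutator i k
      rw [← h2] at h1
      rw [eq_neg_iff_add_eq_zero]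
      simp only [sub_mul, mul_sub, smul_mul_assoc, mul_smul_comm, smul_smul, Complex.I_mul_I,
        majoranaC_mul_majoranaB, smul_sub]
      rw [← sub_eq_zero] at h1
      rw [← h1]
      module
  refine groundEnergy_le_of_eigenvector (hamiltonianPBC_isHermitian hL _) hv ?_
  have h1 (j : Fin L) : (cubicTerm j).mulVec v = -(majoranaB (next j)).mulVec v := by
    have h2 : (majoranaB j).mulVec v = (Complex.I • majoranaC j).mulVec v := by
      have := hk j (Finset.mem_univ j)
      rwa [Matrix.sub_mulVec, sub_eq_zero] at this
    have h3 : cubicTerm j = -(majoranaB (next j) * (majoranaB j * (Complex.I • majoranaC j))) := by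
      rw [cubicTerm, majoranaB_anticomm (next_ne hL j).symm]
      simp [mul_assoc]
    rw [h3, Matrix.neg_mulVec, ← Matrix.mulVec_mulVec, ← Matrix.mulVec_mulVec, ← h2,
      Matrix.mulVec_mulVec (M := majoranaB j), majoranaB_mul_self, Matrix.one_mulVec]
  have h2 : (superchargePBC L (1 / 2)).mulVec v = 0 := by
    rw [superchargePBC_eq, Matrix.add_mulVec, Matrix.smul_mulVec, Matrix.smul_mulVec,
      Matrix.sum_mulVec, Matrix.sum_mulVec]
    simp only [h1, Finset.sum_neg_distrib]
    -- Translation invariance matches the linear and cubic parts, which cancel since the weights `1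
    -- - α` and `α` agree.
    have : ∑ j : Fin L, (majoranaB (next j)).mulVec v = ∑ j : Fin L, (majoranaB j).mulVec v :=
      Equiv.sum_comp (finRotate L) fun j => (majoranaB j).mulVec v
    rw [this]
    module
  rw [hamiltonianPBC, Matrix.smul_mulVec, sq, ← Matrix.mulVec_mulVec, h2]
  simp

end Supercharge

/-! ### Cutting the open chain into two fermionic blocks. -/

noncomputable section Split

variable {m n : ℕ}

/-- The operator `A ⊗ B` on a chain of `m + n` sites. -/
def splitOp (A : Op m) (B : Op n) : Op (m + n) :=
  Matrix.of fun s t => A (fun i => s (Fin.castAdd n i)) (fun i => t (Fin.castAdd n i)) *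
    B (fun i => s (Fin.natAdd m i)) (fun i => t (Fin.natAdd m i))

/-- The product state `v ⊗ w` on a chain of `m + n` sites. -/
def splitVec (v : Config m → ℂ) (w : Config n → ℂ) : Config (m + n) → ℂ :=
  fun s => v (fun i => s (Fin.castAdd n i)) * w (fun i => s (Fin.natAdd m i))

lemma sum_config_add (f : Config (m + n) → ℂ) :
    ∑ s, f s = ∑ s : Config m, ∑ t : Config n, f (Fin.append s t) := by
  rw [← (Fin.appendEquiv m n).sum_comp, Fintype.sum_prod_type]
  rfl

lemma splitOp_mulVec (A : Op m) (B : Op n) (v : Config m → ℂ) (w : Config n → ℂ) :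
    (splitOp A B).mulVec (splitVec v w) = splitVec (A.mulVec v) (B.mulVec w) := by
  ext s
  simp only [Matrix.mulVec, dotProduct, splitVec, splitOp, Matrix.of_apply, sum_config_add,
    Fin.append_left, Fin.append_right, Finset.sum_mul_sum]
  refine Finset.sum_congr rfl fun _ _ => Finset.sum_congr rfl fun _ _ => ?_
  ring

lemma splitOp_mul (A A' : Op m) (B B' : Op n) :
    splitOp A B * splitOp A' B' = splitOp (A * A') (B * B') := by
  ext s t
  simp only [Matrix.mul_apply, splitOp, Matrix.of_apply, sum_config_add,
    Fin.append_left, Fin.append_right, Finset.sum_mul_sum]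
  refine Finset.sum_congr rfl fun _ _ => Finset.sum_congr rfl fun _ _ => ?_
  ring

lemma splitVec_ne_zero {v : Config m → ℂ} {w : Config n → ℂ} (hv : v ≠ 0) (hw : w ≠ 0) :
    splitVec v w ≠ 0 := by
  obtain ⟨s, hs⟩ := Function.ne_iff.1 hv
  obtain ⟨t, ht⟩ := Function.ne_iff.1 hw
  refine Function.ne_iff.2 ⟨Fin.append s t, ?_⟩
  simpa [splitVec] using And.intro hs ht

lemma splitOp_add_left (A A' : Op m) (B : Op n) :
    splitOp (A + A') B = splitOp A B + splitOp A' B := by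
  ext s t; simp [splitOp, add_mul]

lemma splitOp_add_right (A : Op m) (B B' : Op n) :
    splitOp A (B + B') = splitOp A B + splitOp A B' := by
  ext s t; simp [splitOp, mul_add]

lemma splitOp_smul_left {R : Type*} [SMul R ℂ] [IsScalarTower R ℂ ℂ] (c : R) (A : Op m)
    (B : Op n) : splitOp (c • A) B = c • splitOp A B := by
  ext s t; simp [splitOp, smul_mul_assoc]

lemma splitOp_smul_right {R : Type*} [SMul R ℂ] [SMulCommClass R ℂ ℂ] (c : R) (A : Op m)
    (B : Op n) : splitOp A (c • B) = c • splitOp A B := by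
  ext s t; simp [splitOp, mul_smul_comm]

lemma splitOp_zero_left (B : Op n) : splitOp (0 : Op m) B = 0 := by
  ext s t; simp [splitOp]

lemma splitOp_zero_right (A : Op m) : splitOp A (0 : Op n) = 0 := by
  ext s t; simp [splitOp]

lemma splitOp_sum_left {ι : Type*} (s : Finset ι) (f : ι → Op m) (B : Op n) :
    splitOp (∑ i ∈ s, f i) B = ∑ i ∈ s, splitOp (f i) B :=
  map_sum (AddMonoidHom.mk' (fun A => splitOp A B) fun A A' => splitOp_add_left A A' B) f s

lemma splitOp_sum_right {ι : Type*} (s : Finset ι) (A : Op m) (f : ι → Op n) :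
    splitOp A (∑ i ∈ s, f i) = ∑ i ∈ s, splitOp A (f i) :=
  map_sum (AddMonoidHom.mk' (fun B => splitOp A B) fun B B' => splitOp_add_right A B B') f s

lemma tensorOp_eq_splitOp (A : Fin (m + n) → Matrix (Fin 2) (Fin 2) ℂ) :
    tensorOp A = splitOp (tensorOp fun i => A (Fin.castAdd n i))
      (tensorOp fun i => A (Fin.natAdd m i)) := by
  ext s t
  simp [tensorOp, splitOp, Fin.prod_univ_add]

lemma jordanWigner_castAdd (S : Matrix (Fin 2) (Fin 2) ℂ) (j : Fin m) :
    jordanWigner S (Fin.castAdd n j) = splitOp (jordanWigner S j) 1 := by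
  rw [jordanWigner, tensorOp_eq_splitOp, jordanWigner, ← tensorOp_one]
  congr 2
  · ext1 i
    simp only [Fin.lt_def, Fin.ext_iff, Fin.val_castAdd]
  · ext1 i
    have h1 : ¬ Fin.natAdd m i < Fin.castAdd n j := by rw [Fin.lt_def]; simp; omega
    have h2 : Fin.natAdd m i ≠ Fin.castAdd n j := by simp [Fin.ext_iff]; omega
    rw [if_neg h1, if_neg h2]

/-- The string of a site in the right block runs over the whole left block and leaves its parity
there; this makes the tensor product graded. -/
lemma jordanWigner_natAdd (S : Matrix (Fin 2) (Fin 2) ℂ) (j : Fin n) :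
    jordanWigner S (Fin.natAdd m j) = splitOp (fermionParity m) (jordanWigner S j) := by
  rw [jordanWigner, tensorOp_eq_splitOp, jordanWigner, fermionParity]
  congr 2
  · ext1 i
    have h1 : Fin.castAdd n i < Fin.natAdd m j := by rw [Fin.lt_def]; simp; omega
    rw [if_pos h1]
  · ext1 i
    simp only [Fin.lt_def, Fin.ext_iff, Fin.val_natAdd, add_lt_add_iff_left, add_right_inj]

lemma next_castAdd {j : Fin m} (h : j.val + 1 < m) :
    next (Fin.castAdd n j) = Fin.castAdd n (next j) := by
  ext
  rw [next_val_of_lt (by simp; omega), Fin.val_castAdd, Fin.val_castAdd, next_val_of_lt h]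

lemma next_natAdd {j : Fin n} (h : j.val + 1 < n) :
    next (Fin.natAdd m j) = Fin.natAdd m (next j) := by
  ext
  rw [next_val_of_lt (by simp; omega), Fin.val_natAdd, Fin.val_natAdd, next_val_of_lt h, add_assoc]

lemma cubicTerm_castAdd {j : Fin m} (h : j.val + 1 < m) :
    cubicTerm (Fin.castAdd n j) = splitOp (cubicTerm j) 1 := by
  rw [cubicTerm, cubicTerm, next_castAdd h]
  simp only [majoranaB_eq, majoranaC_eq, jordanWigner_castAdd, splitOp_mul, splitOp_smul_left,
    mul_one]

/-- Three strings cross the left block, and the cube of the parity is the parity. -/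
lemma cubicTerm_natAdd {j : Fin n} (h : j.val + 1 < n) :
    cubicTerm (Fin.natAdd m j) = splitOp (fermionParity m) (cubicTerm j) := by
  rw [cubicTerm, cubicTerm, next_natAdd h]
  simp only [majoranaB_eq, majoranaC_eq, jordanWigner_natAdd, splitOp_mul, splitOp_smul_right,
    fermionParity_mul_self, one_mul]

/-- The supercharge of the open chain with the linear terms on all sites. -/
def superchargeFree (L : ℕ) (α : ℝ) : Op L :=
  (1 - α) • (∑ j : Fin L, majoranaB j) + α • (∑ j : Fin L with j.val + 1 < L, cubicTerm j)

lemma superchargeFree_isHermitian (L : ℕ) (α : ℝ) : (superchargeFree L α).IsHermitian :=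
  (real_smul_isHermitian (sum_majoranaB_isHermitian _) _).add
    (real_smul_isHermitian (isHermitian_sum _ _ fun _ hj =>
      cubicTerm_isHermitian (next_ne_of_lt (Finset.mem_filter.1 hj).2)) _)

/-- Every term is a product of one or three Majoranas, hence odd. This kills the cross terms between
decoupled blocks. -/
lemma superchargeFree_mul_fermionParity (L : ℕ) (α : ℝ) :
    superchargeFree L α * fermionParity L = -(fermionParity L * superchargeFree L α) := by
  have hc (j : Fin L) : cubicTerm j * fermionParity L = -(fermionParity L * cubicTerm j) := by
    rw [cubicTerm, smul_mul_assoc, mul_smul_comm, mul_assoc, majoranaC_mul_fermionParity, mul_neg,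
      ← mul_assoc, mul_assoc (majoranaB j), majoranaB_mul_fermionParity, mul_neg, neg_mul, neg_neg,
      ← mul_assoc, majoranaB_mul_fermionParity]
    simp only [neg_mul, smul_neg, mul_assoc]
  rw [superchargeFree, add_mul, mul_add, smul_mul_assoc, smul_mul_assoc, mul_smul_comm,
    mul_smul_comm, Finset.sum_mul, Finset.sum_mul, Finset.mul_sum, Finset.mul_sum]
  simp only [hc, majoranaB_mul_fermionParity, Finset.sum_neg_distrib, smul_neg]
  abel

/-- Cutting one bond decouples the two halves of the chain. -/
lemma superchargeFree_add (α : ℝ) (p : Fin m) (hp : p.val + 1 = m) (hn : 0 < n) :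
    superchargeFree (m + n) α = splitOp (superchargeFree m α) 1 +
      splitOp (fermionParity m) (superchargeFree n α) + α • cubicTerm (Fin.castAdd n p) := by
  have h1 : ∑ k : Fin (m + n), majoranaB k = splitOp (∑ j : Fin m, majoranaB j) 1 +
      splitOp (fermionParity m) (∑ j : Fin n, majoranaB j) := by
    simp only [Fin.sum_univ_add, majoranaB_eq, jordanWigner_castAdd, jordanWigner_natAdd,
      splitOp_sum_left, splitOp_sum_right]
  have h2 : ∑ k : Fin (m + n) with k.val + 1 < m + n, cubicTerm k =
      splitOp (∑ j : Fin m with j.val + 1 < m, cubicTerm j) 1 +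
      splitOp (fermionParity m) (∑ j : Fin n with j.val + 1 < n, cubicTerm j) +
      cubicTerm (Fin.castAdd n p) := by
    rw [Finset.sum_filter, Finset.sum_filter, Finset.sum_filter, Fin.sum_univ_add,
      splitOp_sum_left, splitOp_sum_right, add_right_comm]
    congr 1
    -- The last site `p` of the left block is the only one whose bond is interior to the long chain
    -- but absent from the block; its term is spread as an indicator sum to compare site by site.
    · have : cubicTerm (Fin.castAdd n p) =
          ∑ j : Fin m, if j = p then cubicTerm (Fin.castAdd n j) else 0 := by simp
      rw [this, ← Finset.sum_add_distrib]
      refine Finset.sum_congr rfl fun j _ => ?_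
      have hj := j.2
      rw [if_pos (by simp; omega)]
      by_cases h : j.val + 1 < m
      · rw [if_pos h, if_neg (by rintro rfl; omega), cubicTerm_castAdd h, add_zero]
      · rw [if_neg h, if_pos (by ext; omega), splitOp_zero_left, zero_add]
    · refine Finset.sum_congr rfl fun j _ => ?_
      by_cases h : j.val + 1 < n
      · rw [if_pos h, if_pos (by simp; omega), cubicTerm_natAdd h]
      · rw [if_neg h, if_neg (by simp; omega), splitOp_zero_right]
  rw [superchargeFree, h1, h2, superchargeFree, superchargeFree, splitOp_add_left,
    splitOp_add_right, splitOp_smul_left, splitOp_smul_left, splitOp_smul_right,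
    splitOp_smul_right]
  module

lemma splitOp_isHermitian {A : Op m} {B : Op n} (hA : A.IsHermitian) (hB : B.IsHermitian) :
    (splitOp A B).IsHermitian := by
  ext s t
  simp only [Matrix.conjTranspose_apply, splitOp, Matrix.of_apply, star_mul', hA.apply, hB.apply]

lemma decoupled_isHermitian {A : Op m} {B : Op n} (hA : A.IsHermitian) (hB : B.IsHermitian) :
    (splitOp A 1 + splitOp (fermionParity m) B).IsHermitian :=
  (splitOp_isHermitian hA Matrix.isHermitian_one).add
    (splitOp_isHermitian fermionParity_isHermitian hB)

/-- A product of ground states is a trial state for two decoupled fermionic chains. -/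
lemma groundEnergy_decoupled_le {A : Op m} {B : Op n} (hA : A.IsHermitian) (hB : B.IsHermitian)
    (hP : A * fermionParity m = -(fermionParity m * A)) :
    groundEnergy ((1 / 2 : ℝ) • (splitOp A 1 + splitOp (fermionParity m) B) ^ 2) ≤
    groundEnergy ((1 / 2 : ℝ) • A ^ 2) + groundEnergy ((1 / 2 : ℝ) • B ^ 2) := by
  obtain ⟨v, hv, hv'⟩ := exists_eigenvector_groundEnergy (half_sq_isHermitian hA)
  obtain ⟨w, hw, hw'⟩ := exists_eigenvector_groundEnergy (half_sq_isHermitian hB)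
  refine groundEnergy_le_of_eigenvector (half_sq_isHermitian (decoupled_isHermitian hA hB))
    (splitVec_ne_zero hv hw) ?_
  have h1 : (1 / 2 : ℝ) • (splitOp A 1 + splitOp (fermionParity m) B) ^ 2 =
      splitOp ((1 / 2 : ℝ) • A ^ 2) 1 + splitOp 1 ((1 / 2 : ℝ) • B ^ 2) := by
    -- Cross terms of the square cancel because `A` is odd, so the two energies simply add.
    have h2 : splitOp (A * fermionParity m) B + splitOp (fermionParity m * A) B = 0 := by
      rw [← splitOp_add_left, hP, neg_add_cancel, splitOp_zero_left]
    rw [splitOp_smul_left, splitOp_smul_right, ← smul_add]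
    congr 1
    simp only [sq, add_mul, mul_add, splitOp_mul, one_mul, mul_one, fermionParity_mul_self]
    rw [eq_neg_of_add_eq_zero_left h2]
    abel
  rw [h1, Matrix.add_mulVec, splitOp_mulVec, splitOp_mulVec, hv', hw', Matrix.one_mulVec,
    Matrix.one_mulVec]
  ext s
  simp only [splitVec, Pi.add_apply, Pi.smul_apply, smul_eq_mul]
  push_cast
  ring

end Split

/-! ### Bounded cost of a cut, subadditivity, and stability of the energy density. -/

section Locality

variable {L : ℕ}

lemma norm_majoranaB_le (j : Fin L) : ‖majoranaB j‖ ≤ 1 :=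
  norm_le_one_of_sq_eq_one (majoranaB_isHermitian j) (majoranaB_mul_self j)

lemma norm_majoranaC_le (j : Fin L) : ‖majoranaC j‖ ≤ 1 :=
  norm_le_one_of_sq_eq_one (majoranaC_isHermitian j) (majoranaC_mul_self j)

lemma norm_cubicTerm_le {j : Fin L} (h : next j ≠ j) : ‖cubicTerm j‖ ≤ 1 :=
  norm_le_one_of_sq_eq_one (cubicTerm_isHermitian h) (cubicTerm_mul_self h)

lemma norm_real_smul_le (c : ℝ) (A : Op L) : ‖c • A‖ ≤ |c| * ‖A‖ := by
  rw [← Complex.coe_smul]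
  exact (norm_smul_le _ _).trans_eq (by simp)

lemma norm_mul_le_one {A B : Op L} (hA : ‖A‖ ≤ 1) (hB : ‖B‖ ≤ 1) : ‖A * B‖ ≤ 1 :=
  (norm_mul_le _ _).trans (mul_le_one₀ hA (norm_nonneg _) hB)

lemma norm_anticommutator_le {A B : Op L} (hA : ‖A‖ ≤ 1) (hB : ‖B‖ ≤ 1) :
    ‖A * B + B * A‖ ≤ 2 :=
  (norm_add_le _ _).trans (by
    linarith [norm_mul_le_one hA hB, norm_mul_le_one hB hA])

lemma norm_sum_majoranaB_anticommutator_cubicTerm_le (p : Fin L) :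
    ‖(∑ k, majoranaB k) * cubicTerm p + cubicTerm p * (∑ k, majoranaB k)‖ ≤ 4 := by
  rw [sum_majoranaB_anticommutator_cubicTerm]
  have h (j k : Fin L) : ‖Complex.I • (majoranaB j * majoranaC k)‖ ≤ 1 := by
    refine (norm_smul_le _ _).trans ?_
    rw [Complex.norm_I, one_mul]
    exact norm_mul_le_one (norm_majoranaB_le j) (norm_majoranaC_le k)
  refine (norm_real_smul_le _ _).trans ?_
  rw [abs_two]
  have := (norm_sub_le (Complex.I • (majoranaB (next p) * majoranaC p))
    (Complex.I • (majoranaB p * majoranaC p))).trans (add_le_add (h _ _) (h _ _))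
  linarith

/-- Cubic terms without a common site anticommute. -/
lemma cubicTerm_anticomm {j p : Fin L} (h1 : j ≠ p) (h2 : j ≠ next p) (h3 : next j ≠ p)
    (h4 : next j ≠ next p) : cubicTerm j * cubicTerm p = -(cubicTerm p * cubicTerm j) := by
  -- Each of the three Majoranas of the term at `j` passes the term at `p` with one sign; three
  -- signs give the anticommutation.
  have hB (k : Fin L) (hk : k ≠ p) (hk' : k ≠ next p) :
      majoranaB k * cubicTerm p = -(cubicTerm p * majoranaB k) := by
    have := majoranaB_anticommutator_cubic k p (next p)
    rw [if_neg hk, if_neg hk', zero_mul, zero_mul, sub_zero] at this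
    rw [cubicTerm, mul_smul_comm, smul_mul_assoc, eq_neg_of_add_eq_zero_left this, smul_neg]
  have hC : majoranaC j * cubicTerm p = -(cubicTerm p * majoranaC j) := by
    rw [cubicTerm, mul_smul_comm, smul_mul_assoc, ← mul_assoc, ← mul_assoc,
      majoranaC_mul_majoranaB, neg_mul, mul_assoc (majoranaB p), majoranaC_mul_majoranaB, mul_neg,
      neg_mul, neg_mul, neg_neg, mul_assoc, mul_assoc, majoranaC_anticomm h1]
    simp only [mul_neg, smul_neg, mul_assoc]
  nth_rewrite 1 [cubicTerm]
  rw [smul_mul_assoc, mul_assoc, hC, mul_neg, ← mul_assoc, mul_assoc (majoranaB j), hB _ h3 h4,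
    mul_neg, neg_mul, neg_neg, ← mul_assoc, hB _ h1 h2]
  nth_rewrite 3 [cubicTerm]
  rw [mul_smul_comm]
  simp only [neg_mul, smul_neg, mul_assoc]

/-- Only the bonds `p - 1`, `p`, `p + 1` can share a site with `p`; each contributes norm at most
`2`, uniformly in `L`. -/
lemma norm_sum_cubicTerm_anticommutator_le {p : Fin L} (hp : p.val + 1 < L) :
    ‖(∑ j : Fin L with j.val + 1 < L, cubicTerm j) * cubicTerm p +
      cubicTerm p * (∑ j : Fin L with j.val + 1 < L, cubicTerm j)‖ ≤ 6 := by
  rw [Finset.sum_mul, Finset.mul_sum, ← Finset.sum_add_distrib]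
  set s : Finset (Fin L) := Finset.univ.filter fun j => j.val + 1 < L with hs
  set t : Finset (Fin L) := s.filter fun j => p.val ≤ j.val + 1 ∧ j.val ≤ p.val + 1 with ht
  have h1 : ∑ j ∈ s, (cubicTerm j * cubicTerm p + cubicTerm p * cubicTerm j) =
      ∑ j ∈ t, (cubicTerm j * cubicTerm p + cubicTerm p * cubicTerm j) := by
    refine (Finset.sum_subset (Finset.filter_subset _ _) fun j hj hjt => ?_).symm
    have hj' : j.val + 1 < L := (Finset.mem_filter.1 hj).2
    have hjt' : ¬ (p.val ≤ j.val + 1 ∧ j.val ≤ p.val + 1) := fun h =>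
      hjt (Finset.mem_filter.2 ⟨hj, h⟩)
    have e1 := next_val_of_lt hj'
    have e2 := next_val_of_lt hp
    rw [cubicTerm_anticomm, neg_add_cancel] <;> rw [Ne, Fin.ext_iff] <;> omega
  have h2 : t.card ≤ 3 := by
    have : t.card ≤ (Finset.Icc (p.val - 1) (p.val + 1)).card := by
      refine Finset.card_le_card_of_injOn Fin.val (fun j hj => ?_) Fin.val_injective.injOn
      have := (Finset.mem_filter.1 hj).2
      simp
      omega
    rw [Nat.card_Icc] at this
    omega
  rw [h1]
  refine (norm_sum_le_of_le t (f := fun j => cubicTerm j * cubicTerm p + cubicTerm p * cubicTerm j)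
    (n := fun _ => 2) fun j hj => ?_).trans ?_
  · have hj' : j.val + 1 < L := (Finset.mem_filter.1 (Finset.mem_filter.1 hj).1).2
    exact norm_anticommutator_le (norm_cubicTerm_le (next_ne_of_lt hj'))
      (norm_cubicTerm_le (next_ne_of_lt hp))
  · rw [Finset.sum_const, nsmul_eq_mul]
    have : (t.card : ℝ) ≤ 3 := by exact_mod_cast h2
    linarith

/-- The ground-state energy of the open chain is subadditive up to a constant. -/
lemma groundEnergy_superchargeFree_add_le {m n : ℕ} (hm : 0 < m) (hn : 0 < n) {α : ℝ}
    (hα : α ∈ Set.Icc (0 : ℝ) 1) :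
    groundEnergy ((1 / 2 : ℝ) • superchargeFree (m + n) α ^ 2) ≤
      groundEnergy ((1 / 2 : ℝ) • superchargeFree m α ^ 2) +
        groundEnergy ((1 / 2 : ℝ) • superchargeFree n α ^ 2) + 6 := by
  set p : Fin m := ⟨m - 1, by omega⟩ with hp
  have hsplit := superchargeFree_add (n := n) α p (by simp [hp]; omega) hn
  have hq : (Fin.castAdd n p).val + 1 < m + n := by simp [hp]; omega
  set q := Fin.castAdd n p
  set R := superchargeFree (m + n) α with hR
  set Q := splitOp (superchargeFree m α) 1 + splitOp (fermionParity m) (superchargeFree n α)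
  have hQh : Q.IsHermitian :=
    decoupled_isHermitian (superchargeFree_isHermitian m α) (superchargeFree_isHermitian n α)
  have hRh : R.IsHermitian := superchargeFree_isHermitian _ _
  have hQ := groundEnergy_decoupled_le (superchargeFree_isHermitian m α)
    (superchargeFree_isHermitian n α) (superchargeFree_mul_fermionParity m α)
  refine (groundEnergy_le_add_norm (c := 6) (half_sq_isHermitian hQh) (half_sq_isHermitian hRh)
    ?_).trans (add_le_add_left hQ _)
  have hQR : Q = R - α • cubicTerm q := by rw [hsplit]; abel
  set B : Op (m + n) := ∑ j : Fin (m + n), majoranaB j with hB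
  set C : Op (m + n) := ∑ j : Fin (m + n) with j.val + 1 < m + n, cubicTerm j with hC
  have hRBC : R = (1 - α) • B + α • C := rfl
  have hd : cubicTerm q * cubicTerm q = 1 := cubicTerm_mul_self (next_ne_of_lt hq)
  -- With `d` the cut term and `Q = R - α d`, one has `R² - Q² = α{R, d} - α² d²` and `d² = 1`. The
  -- three norms are at most `2`, `3` and `1/2`, within the allowed `6`.
  have h1 : (1 / 2 : ℝ) • R ^ 2 - (1 / 2 : ℝ) • Q ^ 2 =
      (1 / 2 * (α * (1 - α))) • (B * cubicTerm q + cubicTerm q * B) +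
      (1 / 2 * α ^ 2) • (C * cubicTerm q + cubicTerm q * C) -
      (1 / 2 * α ^ 2) • (1 : Op (m + n)) := by
    rw [hQR, ← hd, hRBC]
    simp only [sq, add_mul, mul_add, sub_mul, mul_sub, smul_mul_assoc, mul_smul_comm]
    module
  rw [h1]
  have h2 := norm_sum_majoranaB_anticommutator_cubicTerm_le q
  have h3 := norm_sum_cubicTerm_anticommutator_le hq
  have ha := hα.1
  have hb : 0 ≤ 1 - α := sub_nonneg.2 hα.2
  have n1 := norm_real_smul_le (1 / 2 * (α * (1 - α))) (B * cubicTerm q + cubicTerm q * B)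
  have n2 := norm_real_smul_le (1 / 2 * α ^ 2) (C * cubicTerm q + cubicTerm q * C)
  have n3 := norm_real_smul_le (1 / 2 * α ^ 2) (1 : Op (m + n))
  rw [abs_of_nonneg (by positivity)] at n1 n2 n3
  rw [norm_one] at n3
  have c1 : 1 / 2 * (α * (1 - α)) ≤ 1 / 2 := by nlinarith
  have c2 : 1 / 2 * α ^ 2 ≤ 1 / 2 := by nlinarith
  have m1 : 1 / 2 * (α * (1 - α)) * ‖B * cubicTerm q + cubicTerm q * B‖ ≤ 1 / 2 * 4 :=
    mul_le_mul c1 h2 (norm_nonneg _) (by norm_num)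
  have m2 : 1 / 2 * α ^ 2 * ‖C * cubicTerm q + cubicTerm q * C‖ ≤ 1 / 2 * 6 :=
    mul_le_mul c2 h3 (norm_nonneg _) (by norm_num)
  refine (norm_sub_le _ _).trans ((add_le_add_left (norm_add_le _ _) _).trans ?_)
  linarith

lemma exists_tendsto_groundEnergy_superchargeFree {α : ℝ} (hα : α ∈ Set.Icc (0 : ℝ) 1) :
    ∃ e : ℝ, Tendsto (fun L : ℕ => groundEnergy ((1 / 2 : ℝ) • superchargeFree L α ^ 2) / (L : ℝ))
      atTop (𝓝 e) := by
  set E : ℕ → ℝ := fun L => groundEnergy ((1 / 2 : ℝ) • superchargeFree L α ^ 2) with hE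
  have hE0 (L : ℕ) : 0 ≤ E L := groundEnergy_half_sq_nonneg (superchargeFree_isHermitian L α)
  -- The shift by `6` absorbs the cost of a cut and disappears after division by `L`. Empty blocks
  -- cannot be cut and are covered by `0 ≤ E 0`.
  have hsub : Subadditive fun L => E L + 6 := by
    intro m n
    rcases Nat.eq_zero_or_pos m with rfl | hm
    · have := hE0 0
      simp only [zero_add]
      linarith
    rcases Nat.eq_zero_or_pos n with rfl | hn
    · have := hE0 0
      simp only [add_zero]
      linarith
    · have := groundEnergy_superchargeFree_add_le hm hn hα
      simp only [hE]
      linarith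
  have h1 := hsub.tendsto_lim ⟨0, by
    rintro _ ⟨L, rfl⟩
    exact div_nonneg (by linarith [hE0 L]) (Nat.cast_nonneg L)⟩
  have h2 := h1.sub (tendsto_const_div_atTop_nhds_zero_nat (6 : ℝ))
  exact ⟨_, h2.congr fun L => by ring⟩

/-- Charges at bounded distance have the same ground-state energy density. -/
lemma tendsto_groundEnergy_of_norm_sub_le {R S : (L : ℕ) → Op L} {C e : ℝ}
    (hR : ∀ᶠ L in atTop, (R L).IsHermitian) (hS : ∀ᶠ L in atTop, (S L).IsHermitian)
    (h : ∀ᶠ L in atTop, ‖S L - R L‖ ≤ C)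
    (he : Tendsto (fun L : ℕ => groundEnergy ((1 / 2 : ℝ) • R L ^ 2) / (L : ℝ)) atTop (𝓝 e)) :
    Tendsto (fun L : ℕ => groundEnergy ((1 / 2 : ℝ) • S L ^ 2) / (L : ℝ)) atTop (𝓝 e) := by
  -- The choice `ε = 1/√L` sends to zero both `ε` and the error `(1 + 1/ε)/L = 1/L + 1/√L`.
  have hε : Tendsto (fun L : ℕ => (√(L : ℝ))⁻¹) atTop (𝓝 0) :=
    tendsto_inv_atTop_zero.comp (Real.tendsto_sqrt_atTop.comp tendsto_natCast_atTop_atTop)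
  have hN : Tendsto (fun L : ℕ => (1 : ℝ) / (L : ℝ)) atTop (𝓝 0) :=
    tendsto_const_div_atTop_nhds_zero_nat _
  have hδ : Tendsto (fun L : ℕ => (1 / (L : ℝ) + (√(L : ℝ))⁻¹) * (C ^ 2 / 2)) atTop (𝓝 0) := by
    simpa using (hN.add hε).mul_const (C ^ 2 / 2)
  have h1ε : Tendsto (fun L : ℕ => 1 + (√(L : ℝ))⁻¹) atTop (𝓝 1) := by
    simpa using hε.const_add 1
  have hup := (h1ε.mul he).add hδ
  have hlo := (he.sub hδ).div h1ε one_ne_zero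
  rw [one_mul, add_zero] at hup
  rw [sub_zero, div_one] at hlo
  -- Applied in both directions, this estimate gives the two sides of the squeeze.
  have key (A B : (L : ℕ) → Op L) (L : ℕ) (hL : 0 < L) (hA : (A L).IsHermitian)
      (hB : (B L).IsHermitian) (hAB : ‖B L - A L‖ ≤ C) :
      groundEnergy ((1 / 2 : ℝ) • B L ^ 2) / (L : ℝ) ≤
        (1 + (√(L : ℝ))⁻¹) * (groundEnergy ((1 / 2 : ℝ) • A L ^ 2) / (L : ℝ)) +
          (1 / (L : ℝ) + (√(L : ℝ))⁻¹) * (C ^ 2 / 2) := by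
    have hL' : (0 : ℝ) < L := by exact_mod_cast hL
    have hs : 0 < √(L : ℝ) := Real.sqrt_pos.2 hL'
    have h1 := groundEnergy_half_sq_le hA hB hAB (inv_pos.2 hs)
    rw [div_le_iff₀ hL']
    refine h1.trans_eq ?_
    have h2 : (L : ℝ) = √(L : ℝ) ^ 2 := (Real.sq_sqrt hL'.le).symm
    generalize groundEnergy ((1 / 2 : ℝ) • A L ^ 2) = E
    generalize √(L : ℝ) = s at h2 hs
    rw [h2]
    field_simp
  refine tendsto_of_tendsto_of_tendsto_of_le_of_le' hlo hup ?_ ?_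
  · filter_upwards [hR, hS, h, eventually_gt_atTop 0] with L hR hS h hL
    have h1 := key S R L hL hS hR (by rwa [norm_sub_rev])
    have hpos : 0 < 1 + (√(L : ℝ))⁻¹ := by positivity
    simp only [Pi.div_apply]
    rw [div_le_iff₀ hpos]
    linarith
  · filter_upwards [hR, hS, h, eventually_gt_atTop 0] with L hR hS h hL
    exact key R S L hL hR hS h

end Locality

/-! ### The energy density, broken supersymmetry, and the critical point. -/

section EnergyDensity

variable {L : ℕ}

lemma superchargeOBC_isHermitian (L : ℕ) (α : ℝ) : (superchargeOBC L α).IsHermitian :=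
  (real_smul_isHermitian (sum_majoranaB_isHermitian _) _).add
    (real_smul_isHermitian (isHermitian_sum _ _ fun _ hj =>
      cubicTerm_isHermitian (next_ne_of_lt (Finset.mem_filter.1 hj).2)) _)

lemma norm_sum_le_card (s : Finset (Fin L)) (f : Fin L → Op L) (hf : ∀ j, ‖f j‖ ≤ 1) :
    ‖∑ j ∈ s, f j‖ ≤ s.card :=
  (norm_sum_le_of_le s fun j _ => hf j).trans_eq (by simp)

/-- Only the linear terms at the two end sites differ. -/
lemma norm_superchargeOBC_sub_le {α : ℝ} (hα : α ∈ Set.Icc (0 : ℝ) 1) :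
    ‖superchargeOBC L α - superchargeFree L α‖ ≤ 2 := by
  have h1 := Finset.sum_filter_add_sum_filter_not (Finset.univ : Finset (Fin L))
    (fun j => 0 < j.val ∧ j.val + 1 < L) fun j => (majoranaB j : Op L)
  have h2 : superchargeOBC L α - superchargeFree L α =
      (-(1 - α)) • ∑ j : Fin L with ¬(0 < j.val ∧ j.val + 1 < L), majoranaB j := by
    rw [superchargeOBC, superchargeFree, ← h1]
    module
  have h3 : (Finset.univ.filter fun j : Fin L => ¬(0 < j.val ∧ j.val + 1 < L)).card ≤ 2 := by
    refine (Finset.card_le_card_of_injOn (t := {0, L - 1}) Fin.val (fun j hj => ?_)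
      Fin.val_injective.injOn).trans Finset.card_le_two
    have := (Finset.mem_filter.1 hj).2
    simp
    omega
  have h4 := norm_sum_le_card (Finset.univ.filter fun j : Fin L => ¬(0 < j.val ∧ j.val + 1 < L))
    (fun j => majoranaB j) norm_majoranaB_le
  have h5 : |-(1 - α)| ≤ 1 := by rw [abs_neg, abs_le]; constructor <;> linarith [hα.1, hα.2]
  rw [h2]
  refine (norm_real_smul_le _ _).trans ((mul_le_mul h5 h4 (norm_nonneg _) zero_le_one).trans ?_)
  rw [one_mul]
  exact_mod_cast h3

/-- Only the bond that wraps around differs; counting it as at most two sites is enough. -/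
lemma norm_superchargePBC_sub_le (hL : 2 ≤ L) {α : ℝ} (hα : α ∈ Set.Icc (0 : ℝ) 1) :
    ‖superchargePBC L α - superchargeFree L α‖ ≤ 2 := by
  have h1 := Finset.sum_filter_add_sum_filter_not (Finset.univ : Finset (Fin L))
    (fun j => j.val + 1 < L) fun j => (cubicTerm j : Op L)
  have h2 : superchargePBC L α - superchargeFree L α =
      α • ∑ j : Fin L with ¬(j.val + 1 < L), cubicTerm j := by
    rw [superchargePBC_eq, superchargeFree, ← h1]
    module
  have h3 : (Finset.univ.filter fun j : Fin L => ¬(j.val + 1 < L)).card ≤ 2 := by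
    refine (Finset.card_le_card_of_injOn (t := {0, L - 1}) Fin.val (fun j hj => ?_)
      Fin.val_injective.injOn).trans Finset.card_le_two
    have := (Finset.mem_filter.1 hj).2
    simp
    omega
  have h4 := norm_sum_le_card (Finset.univ.filter fun j : Fin L => ¬(j.val + 1 < L))
    (fun j => cubicTerm j) fun j => norm_cubicTerm_le (next_ne hL j)
  have h5 : |α| ≤ 1 := by rw [abs_le]; constructor <;> linarith [hα.1, hα.2]
  rw [h2]
  refine (norm_real_smul_le _ _).trans ((mul_le_mul h5 h4 (norm_nonneg _) zero_le_one).trans ?_)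
  rw [one_mul]
  exact_mod_cast h3

lemma tendsto_energyDensity {α : ℝ} (hα : α ∈ Set.Icc (0 : ℝ) 1) :
    Tendsto (fun L : ℕ => groundEnergy (hamiltonianPBC L α) / (L : ℝ)) atTop
        (𝓝 (energyDensity α)) ∧
      Tendsto (fun L : ℕ => groundEnergy (hamiltonianOBC L α) / (L : ℝ)) atTop
        (𝓝 (energyDensity α)) := by
  obtain ⟨e, he⟩ := exists_tendsto_groundEnergy_superchargeFree hα
  have hF : ∀ᶠ L in atTop, (superchargeFree L α).IsHermitian :=
    Eventually.of_forall fun L => superchargeFree_isHermitian L α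
  have hP : Tendsto (fun L : ℕ => groundEnergy (hamiltonianPBC L α) / (L : ℝ)) atTop (𝓝 e) :=
    tendsto_groundEnergy_of_norm_sub_le hF
      ((eventually_ge_atTop 2).mono fun L hL => superchargePBC_isHermitian hL α)
      ((eventually_ge_atTop 2).mono fun L hL => norm_superchargePBC_sub_le hL hα) he
  have hO : Tendsto (fun L : ℕ => groundEnergy (hamiltonianOBC L α) / (L : ℝ)) atTop (𝓝 e) :=
    tendsto_groundEnergy_of_norm_sub_le hF
      (Eventually.of_forall fun L => superchargeOBC_isHermitian L α)
      (Eventually.of_forall fun L => norm_superchargeOBC_sub_le hα) he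
  -- `limUnder` is meaningful only once convergence is known, which is transferred here from the
  -- auxiliary chain.
  rw [show energyDensity α = e from hP.limUnder_eq]
  exact ⟨hP, hO⟩

lemma le_energyDensity {α : ℝ} (hα : α ∈ Set.Icc (0 : ℝ) 1) :
    (1 - α) ^ 2 / 2 - 4 * α * (1 - α) / Real.pi ≤ energyDensity α := by
  have h1 := (tendsto_groundEnergy_kitaevPBC.const_mul (α * (1 - α))).const_add ((1 - α) ^ 2 / 2)
  refine (le_of_eq (by ring)).trans (le_of_tendsto_of_tendsto h1 (tendsto_energyDensity hα).1 ?_)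
  filter_upwards [eventually_ge_atTop 2] with L hL
  have hL' : (0 : ℝ) < L := by positivity
  rw [le_div_iff₀ hL']
  refine (le_of_eq ?_).trans (le_groundEnergy_hamiltonianPBC hL hα)
  field_simp

lemma susyBroken_of_lt {α : ℝ} (hα : α ∈ Set.Ico (0 : ℝ) (Real.pi / (8 + Real.pi))) :
    SusyBroken α := by
  have hpi := Real.pi_pos
  have h1 : α * (8 + Real.pi) < Real.pi := (lt_div_iff₀ (by positivity)).1 hα.2
  have h2 : α < 1 := by nlinarith [hα.1]
  refine lt_of_lt_of_le ?_ (le_energyDensity ⟨hα.1, h2.le⟩)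
  -- The factored lower bound shows the threshold: its second factor vanishes at `α = π/(8 + π)`.
  have h3 : (1 - α) ^ 2 / 2 - 4 * α * (1 - α) / Real.pi =
      (1 - α) * (Real.pi - α * (8 + Real.pi)) / (2 * Real.pi) := by
    field_simp
    ring
  rw [h3]
  exact div_pos (mul_pos (sub_pos.2 h2) (sub_pos.2 h1)) (by positivity)

lemma energyDensity_half : energyDensity (1 / 2) = 0 := by
  refine tendsto_nhds_unique (tendsto_energyDensity (α := 1 / 2) (by norm_num)).1 ?_
  refine tendsto_const_nhds.congr' ?_
  filter_upwards [eventually_ge_atTop 2] with L hL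
  rw [groundEnergy_hamiltonianPBC_half hL, zero_div]

lemma criticalPoint_bounds {αc : ℝ} (h : IsCriticalPoint αc) :
    Real.pi / (8 + Real.pi) ≤ αc ∧ αc ≤ 1 / 2 := by
  obtain ⟨⟨h0, _⟩, hlt, hgt⟩ := h
  have hpi := Real.pi_pos
  constructor
  · by_contra! hc
    -- A point between `αc` and the threshold would be both broken and unbroken.
    obtain ⟨α, h1, h2⟩ := exists_between hc
    have h3 : Real.pi / (8 + Real.pi) ≤ 1 := (div_le_one (by positivity)).2 (by linarith)
    exact hgt α ⟨h1, h2.le.trans h3⟩ (susyBroken_of_lt ⟨h0.trans h1.le, h2⟩)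
  · by_contra! hc
    exact (hlt (1 / 2) ⟨by norm_num, hc⟩).ne' energyDensity_half

end EnergyDensity

end SusyMajorana

theorem mainTheorem3 :
    -- the interaction is non-negative, and the critical Kitaev chain has energy density `-4 / π`
    (∀ L : ℕ, 2 ≤ L → (interactionPBC L).PosSemidef) ∧
    Tendsto (fun L : ℕ => groundEnergy (kitaevPBC L) / (L : ℝ)) atTop (𝓝 (-(4 / Real.pi))) ∧
    -- the energy density exists, is the same for both boundary conditions, and is bounded below
    (∀ α ∈ Set.Icc (0 : ℝ) 1,
      Tendsto (fun L : ℕ => groundEnergy (hamiltonianPBC L α) / (L : ℝ)) atTop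
        (𝓝 (energyDensity α)) ∧
      Tendsto (fun L : ℕ => groundEnergy (hamiltonianOBC L α) / (L : ℝ)) atTop
        (𝓝 (energyDensity α)) ∧
      (1 - α) ^ 2 / 2 - 4 * α * (1 - α) / Real.pi ≤ energyDensity α) ∧
    -- supersymmetry is spontaneously broken for small `α`, and it is unbroken at `α = 1 / 2`
    (∀ α ∈ Set.Ico (0 : ℝ) (Real.pi / (8 + Real.pi)), SusyBroken α) ∧
    energyDensity (1 / 2) = 0 ∧
    -- location of the critical point
    (∀ αc : ℝ, IsCriticalPoint αc → Real.pi / (8 + Real.pi) ≤ αc ∧ αc ≤ 1 / 2) := by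
  exact ⟨fun L hL => interactionPBC_posSemidef hL, tendsto_groundEnergy_kitaevPBC,
    fun α hα => ⟨(tendsto_energyDensity hα).1, (tendsto_energyDensity hα).2, le_energyDensity hα⟩,
    fun α hα => susyBroken_of_lt hα, energyDensity_half, fun αc h => criticalPoint_bounds h⟩
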